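/- Let $V$ be a vector space over a field $\mathbb F$ with a linearly ordered basis $\mathbb B$, and let $p\in\mathbb F$, $p\neq 0$. For $a,b\in\mathbb B$ put $\theta_{a,b}=1$ if $a>b$ and $\theta_{a,b}=0$ otherwise, and for finite $A,B\subseteq\mathbb B$ put $\theta_{A,B}=\sum_{a\in A}\sum_{b\in B}\theta_{a,b}$. Let $\tau\colon V\otimes V\to V\otimes V$ be the braiding $\tau(a\otimes b)=(p^{\theta_{a,b}}-1)\,a\otimes b-p^{\theta_{b,a}}\,b\otimes a$ ($a,b\in\mathbb B$), and let $\hat\tau$ be the braiding it induces on the exterior algebra $\Lambda_p(V)=\bigwedge V$: the quotient of the map on $T(V)\otimes T(V)$ that extends $\tau$ and is compatible with the unit and, via the fusion relation $\hat\tau(\nabla\otimes\nabla)=(\nabla\otimes\nabla)(\mathrm{id}\otimes\hat\tau\otimes\mathrm{id})(\hat\tau\otimes\hat\tau)(\mathrm{id}\otimes\hat\tau\otimes\mathrm{id})$, with the product $\nabla$. For finite $E\subseteq\mathbb B$ let $f_E\in\bigwedge V$ be the product of the elements of $E$ in increasing order; these form a basis of $\bigwedge V$. Write $f_{E,F}=f_E\otimes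 f_F$. For finite $E,F\subseteq\mathbb B$, $G\subseteq E\setminus F$ and $H\subseteq F\setminus E$, put $$E'=(E\setminus G)\cup H,\quad F'=(F\setminus H)\cup G,\quad C=E\cap F,\quad \dot F=(F\setminus E)\setminus H,$$ and let $s_{E,G;F,H}$ be $(-1)^{|E||F|}$ times the coefficient of $f_{F',E'}$ in $\hat\tau f_{E,F}$. For $k\ge 0$ let $\tau_k$ (the size-$k$ exchange channel) be the linear map $$\tau_k f_{E,F}=(-1)^{|E||F|}\sum_{G\in\binom{E\setminus F}{k},\ H\in\binom{F\setminus E}{k}} s_{E,G;F,H}\,f_{F',E'},$$ where $\binom{X}{k}$ is the set of $k$-element subsets of $X$. Then: 1. $\hat\tau=\sum_{k\ge0}\tau_k$ (on every element only finitely many terms are nonzero). 2. For all $k\ge 0$, $G\in\binom{E\setminus F}{k}$ and $H\in\binom{F\setminus E}{k}$, $$s_{E,G;F,H}=\beta_{E,G;F,H}:=(-1)^{\theta_{F,E}+\theta_{F',E'}}\,p^{\theta_{G\sqcup C,E}+\theta_{\dot F,E'}}\,\alpha_{G,H},\qquad \alpha_{G,H}:=\prod_{A\in\binom{G}{1}}\bigl(p^{\theta_{A,H}-\theta_{A,G}}-1\bigr).$$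 3. If $p$ is generic, in the sense that it is not a root of unity, then for such $k,G,H$ the coefficient $s_{E,G;F,H}$ is nonzero if and only if $\theta_{A,H}>\theta_{A,G}$ for every $A\in\binom{G}{1}$. -/

import Mathlib

open scoped TensorProduct

noncomputable section

namespace DeformedExterior

/-- The Heaviside symbol `θ_{a,b}`: it is `1` if `a > b` and `0` otherwise. -/
def heaviside {I : Type*} [LinearOrder I] (a b : I) : ℕ := if b < a then 1 else 0

/-- The extension of the Heaviside symbol to finite sets,
`θ_{A,B} = ∑_{a ∈ A} ∑_{b ∈ B} θ_{a,b}`. -/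
def theta {I : Type*} [LinearOrder I] (A B : Finset I) : ℕ :=
  ∑ a ∈ A, ∑ b ∈ B, heaviside a b

/-- The Hecke-type braiding `τ` on `V ⊗ V`, given on the basis `b` by
`τ(a ⊗ c) = (p^{θ_{a,c}} - 1) a ⊗ c - p^{θ_{c,a}} c ⊗ a`. -/
def hecke {K V I : Type*} [Field K] [AddCommGroup V] [Module K V] [LinearOrder I]
    (b : Module.Basis I K V) (p : K) : V ⊗[K] V →ₗ[K] V ⊗[K] V :=
  (b.tensorProduct b).constr K fun x =>
    (p ^ heaviside x.1 x.2 - 1) • (b x.1 ⊗ₜ[K] b x.2) -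
      p ^ heaviside x.2 x.1 • (b x.2 ⊗ₜ[K] b x.1)

section Crossing

variable {K V A : Type*} [Field K] [AddCommGroup V] [Module K V] [Ring A] [Algebra K A]

/-- One vector `w` crossing a strand labelled by `V`:
`t ⊗ v ↦ ∑ (t * j w') ⊗ v'`, where `τ (v ⊗ w) = ∑ w' ⊗ v'`. -/
def stepRight (τ : V ⊗[K] V →ₗ[K] V ⊗[K] V) (j : V →ₗ[K] A) :
    V →ₗ[K] Module.End K (A ⊗[K] V) :=
  LinearMap.compRight K
      (LinearMap.rTensor V (LinearMap.mul' K A ∘ₗ LinearMap.lTensor A j) ∘ₗ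
        (TensorProduct.assoc K A V V).symm.toLinearMap ∘ₗ LinearMap.lTensor A τ) ∘ₗ
    LinearMap.lTensorHom A ∘ₗ (TensorProduct.mk K V V).flip

/-- The crossing `V ⊗ A → A ⊗ V` determined by a right action `P` of `A` on `A ⊗ V`:
`v ⊗ y ↦ (1 ⊗ v) · y`. -/
def crossV (P : A →ₐ[K] (Module.End K (A ⊗[K] V))ᵐᵒᵖ) : V ⊗[K] A →ₗ[K] A ⊗[K] V :=
  TensorProduct.lift <| LinearMap.flip <|
    LinearMap.lcomp K (A ⊗[K] V) (TensorProduct.mk K A V 1) ∘ₗ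
      (MulOpposite.opLinearEquiv K).symm.toLinearMap ∘ₗ P.toLinearMap

/-- One vector `v` crossing a strand labelled by `A`:
`y ⊗ t ↦ ∑ y' ⊗ (j v' * t)`, where `c (v ⊗ y) = ∑ y' ⊗ v'`. -/
def stepLeft (c : V ⊗[K] A →ₗ[K] A ⊗[K] V) (j : V →ₗ[K] A) :
    V →ₗ[K] Module.End K (A ⊗[K] A) :=
  LinearMap.compRight K
      (LinearMap.lTensor A (LinearMap.mul' K A ∘ₗ LinearMap.rTensor A j) ∘ₗ
        (TensorProduct.assoc K A V A).toLinearMap ∘ₗ LinearMap.rTensor A c) ∘ₗ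
    LinearMap.rTensorHom A ∘ₗ TensorProduct.mk K V A

/-- The crossing `A ⊗ A → A ⊗ A` determined by a left action `F` of `A` on `A ⊗ A`:
`x ⊗ y ↦ x · (y ⊗ 1)`. -/
def crossA (F : A →ₐ[K] Module.End K (A ⊗[K] A)) : A ⊗[K] A →ₗ[K] A ⊗[K] A :=
  TensorProduct.lift <|
    LinearMap.lcomp K (A ⊗[K] A) ((TensorProduct.mk K A A).flip 1) ∘ₗ F.toLinearMap

theorem stepRight_apply (τ : V ⊗[K] V →ₗ[K] V ⊗[K] V) (j : V →ₗ[K] A) (w v : V) (t : A) :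
    stepRight τ j w (t ⊗ₜ v) =
      LinearMap.rTensor V (LinearMap.mulLeft K t ∘ₗ j) (τ (v ⊗ₜ w)) := by
  simp only [stepRight, LinearMap.compRight_apply, LinearMap.coe_comp, Function.comp_apply,
    LinearMap.coe_lTensorHom, LinearMap.lTensor_tmul, LinearMap.flip_apply,
    TensorProduct.mk_apply, LinearEquiv.coe_coe]
  induction τ (v ⊗ₜ w) using TensorProduct.induction_on with
  | zero => simp
  | tmul x y => simp
  | add x y hx hy => simp only [TensorProduct.tmul_add, map_add, hx, hy]

theorem crossV_apply (P : A →ₐ[K] (Module.End K (A ⊗[K] V))ᵐᵒᵖ) (v : V) (y : A) :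
    crossV P (v ⊗ₜ y) = (P y).unop (1 ⊗ₜ v) := rfl

theorem crossA_apply (F : A →ₐ[K] Module.End K (A ⊗[K] A)) (x y : A) :
    crossA F (x ⊗ₜ y) = F x (y ⊗ₜ 1) := rfl

theorem stepLeft_apply (c : V ⊗[K] A →ₗ[K] A ⊗[K] V) (j : V →ₗ[K] A) (v : V) (y t : A) :
    stepLeft c j v (y ⊗ₜ t) =
      LinearMap.lTensor A (LinearMap.mulRight K t ∘ₗ j) (c (v ⊗ₜ y)) := by
  simp only [stepLeft, LinearMap.compRight_apply, LinearMap.coe_comp, Function.comp_apply,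
    LinearMap.coe_rTensorHom, LinearMap.rTensor_tmul,
    TensorProduct.mk_apply, LinearEquiv.coe_coe]
  induction c (v ⊗ₜ y) using TensorProduct.induction_on with
  | zero => simp
  | tmul x y => simp
  | add x y hx hy => simp only [TensorProduct.add_tmul, map_add, hx, hy]

end Crossing

/-- A bilinear map that is alternating on a basis is alternating. -/
theorem alt_of_basis {K V I N : Type*} [Field K] [AddCommGroup V] [Module K V] [AddCommGroup N] [Module K N] (b : Module.Basis I K V)
    (B : V →ₗ[K] V →ₗ[K] N) (h0 : ∀ i, B (b i) (b i) = 0)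
    (h1 : ∀ i k, B (b i) (b k) + B (b k) (b i) = 0) (v : V) : B v v = 0 := by
  have h2 : B + B.flip = 0 := b.ext fun i => b.ext fun k => by simpa using h1 i k
  have h3 : ∀ v w, B v w + B w v = 0 := fun v w => by
    simpa using congrArg (fun C => C v w) h2
  have hv : v ∈ Submodule.span K (Set.range b) := by simp [b.span_eq]
  induction hv using Submodule.span_induction with
  | mem x hx => obtain ⟨i, rfl⟩ := hx; exact h0 i
  | zero => simp
  | add x y _ _ hx hy =>
    have := h3 x y
    simp only [map_add, LinearMap.add_apply, hx, hy, zero_add, add_zero]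
    rw [add_comm]; exact this
  | smul a x _ hx => simp [hx]

section Hecke

variable {K V I : Type*} [Field K] [AddCommGroup V] [Module K V] [LinearOrder I]

theorem hecke_apply (b : Module.Basis I K V) (p : K) (i k : I) :
    hecke b p (b i ⊗ₜ b k) =
      (p ^ heaviside i k - 1) • (b i ⊗ₜ[K] b k) - p ^ heaviside k i • (b k ⊗ₜ[K] b i) := by
  rw [← Module.Basis.tensorProduct_apply, hecke, Module.Basis.constr_basis,
    Module.Basis.tensorProduct_apply]

/-- Cancellation behind the compatibility of the braiding with the relations `v * v = 0`. -/
theorem hecke_cancel_right {N : Type*} [AddCommGroup N] [Module K N] (p : K)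
    (W : I → I → I → N) (h0 : ∀ x l, W x x l = 0) (h1 : ∀ x y l, W x y l = -W y x l)
    (a b c : I) :
    ((p ^ heaviside c a - 1) • ((p ^ heaviside a b - 1) • W c a b - p ^ heaviside b a • W c b a) -
      p ^ heaviside a c • ((p ^ heaviside c b - 1) • W a c b - p ^ heaviside b c • W a b c)) +
    ((p ^ heaviside c b - 1) • ((p ^ heaviside b a - 1) • W c b a - p ^ heaviside a b • W c a b) -
      p ^ heaviside b c • ((p ^ heaviside c a - 1) • W b c a - p ^ heaviside a c • W b a c)) = 0 ∧
    ((p ^ heaviside c a - 1) • ((p ^ heaviside a a - 1) • W c a a - p ^ heaviside a a • W c a a) -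
      p ^ heaviside a c • ((p ^ heaviside c a - 1) • W a c a - p ^ heaviside a c • W a a c)) =
      0 := by
  have e1 := h1 a c b
  have e2 := h1 b c a
  have e3 := h1 b a c
  have e4 := h1 a c a
  rw [e1, e2, e3, e4]
  clear e1 e2 e3 e4 h1
  simp only [heaviside]
  constructor
  · rcases lt_trichotomy a b with h | h | h <;> rcases lt_trichotomy a c with h' | h' | h' <;>
      rcases lt_trichotomy b c with h'' | h'' | h'' <;>
      first
      | (exfalso; order)
      | (subst_vars; simp [not_lt_of_gt, *] <;> module)
  · rcases lt_trichotomy a c with h' | h' | h' <;>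
      subst_vars <;> simp [not_lt_of_gt, *]

open ExteriorAlgebra in
theorem stepRight_sq (b : Module.Basis I K V) (p : K) (v : V) :
    ((MulOpposite.opLinearEquiv K).toLinearMap ∘ₗ stepRight (hecke b p) (ι K)) v *
      ((MulOpposite.opLinearEquiv K).toLinearMap ∘ₗ stepRight (hecke b p) (ι K)) v = 0 := by
  change MulOpposite.op (stepRight (hecke b p) (ι K) v) *
    MulOpposite.op (stepRight (hecke b p) (ι K) v) = 0
  rw [← MulOpposite.op_mul, ← MulOpposite.op_zero]
  congr 1
  set X := stepRight (hecke b p) (ι K) with hX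
  have hXe : ∀ (i k : I) (t : ExteriorAlgebra K V), X (b k) (t ⊗ₜ b i) =
      (p ^ heaviside i k - 1) • ((t * ι K (b i)) ⊗ₜ[K] b k) -
        p ^ heaviside k i • ((t * ι K (b k)) ⊗ₜ[K] b i) := by
    intro i k t
    rw [hX, stepRight_apply, hecke_apply]
    simp
  have key : ∀ (i k l : I) (t : ExteriorAlgebra K V),
      X (b i) (X (b k) (t ⊗ₜ b l)) + X (b k) (X (b i) (t ⊗ₜ b l)) = 0 ∧
      X (b i) (X (b i) (t ⊗ₜ b l)) = 0 := by
    intro i k l t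
    have sw : ∀ i k : I, t * ι K (b i) * ι K (b k) = - (t * ι K (b k) * ι K (b i)) := by
      intro i k
      rw [mul_assoc, mul_assoc, ← mul_neg, eq_neg_of_add_eq_zero_left (ι_add_mul_swap _ _)]
    have sq : ∀ i : I, t * ι K (b i) * ι K (b i) = 0 := by
      intro i; rw [mul_assoc, ι_sq_zero, mul_zero]
    have := hecke_cancel_right p
      (fun x y l => (t * ι K (b x) * ι K (b y)) ⊗ₜ[K] b l)
      (fun x l => by simp only [sq, TensorProduct.zero_tmul])
      (fun x y l => by rw [sw x y, TensorProduct.neg_tmul]) i k l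
    simp only [hXe, map_sub, map_smul]
    rw [add_comm]
    exact this
  have hB := alt_of_basis (N := Module.End K (ExteriorAlgebra K V ⊗[K] V)) b ((LinearMap.mul K (Module.End K (ExteriorAlgebra K V ⊗[K] V))).compl₁₂
    X X) (fun i => ?_) (fun i k => ?_) v
  · simpa using hB
  · refine TensorProduct.ext (LinearMap.ext fun t => b.ext fun l => ?_)
    simpa using (key i i l t).2
  · refine TensorProduct.ext (LinearMap.ext fun t => b.ext fun l => ?_)
    simpa using (key i k l t).1

/-- The mirror image of `hecke_cancel_right`. -/
theorem hecke_cancel_left {N : Type*} [AddCommGroup N] [Module K N] (p : K)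
    (W : I → I → I → N) (h0 : ∀ x l, W x x l = 0) (h1 : ∀ x y l, W x y l = -W y x l)
    (a b c : I) :
    ((p ^ heaviside b c - 1) • ((p ^ heaviside a b - 1) • W b c a - p ^ heaviside b a • W a c b) -
      p ^ heaviside c b • ((p ^ heaviside a c - 1) • W c b a - p ^ heaviside c a • W a b c)) +
    ((p ^ heaviside a c - 1) • ((p ^ heaviside b a - 1) • W a c b - p ^ heaviside a b • W b c a) -
      p ^ heaviside c a • ((p ^ heaviside b c - 1) • W c a b - p ^ heaviside c b • W b a c)) = 0 ∧
    ((p ^ heaviside a c - 1) • ((p ^ heaviside a a - 1) • W a c a - p ^ heaviside a a • W a c a) -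
      p ^ heaviside c a • ((p ^ heaviside a c - 1) • W c a a - p ^ heaviside c a • W a a c)) =
      0 := by
  have e1 := h1 c b a
  have e2 := h1 c a b
  have e3 := h1 b a c
  have e4 := h1 c a a
  rw [e1, e2, e3, e4]
  clear e1 e2 e3 e4 h1
  simp only [heaviside]
  constructor
  · rcases lt_trichotomy a b with h | h | h <;> rcases lt_trichotomy a c with h' | h' | h' <;>
      rcases lt_trichotomy b c with h'' | h'' | h'' <;>
      first
      | (exfalso; order)
      | (subst_vars; simp [not_lt_of_gt, *] <;> module)
  · rcases lt_trichotomy a c with h' | h' | h' <;>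
      subst_vars <;> simp [not_lt_of_gt, *]

theorem lTensor_rTensor_comm {M N P Q : Type*} [AddCommGroup M] [Module K M] [AddCommGroup N]
    [Module K N] [AddCommGroup P] [Module K P] [AddCommGroup Q] [Module K Q]
    (g : N →ₗ[K] Q) (f : M →ₗ[K] P) (z : M ⊗[K] N) :
    LinearMap.lTensor P g (LinearMap.rTensor N f z) =
      LinearMap.rTensor Q f (LinearMap.lTensor M g z) := by
  rw [← LinearMap.comp_apply, ← LinearMap.comp_apply, LinearMap.lTensor_comp_rTensor,
    LinearMap.rTensor_comp_lTensor]

theorem ext_left_induction {P : ExteriorAlgebra K V → Prop}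
    (algebraMap : ∀ r : K, P (algebraMap K _ r)) (add : ∀ x y, P x → P y → P (x + y))
    (ι_mul : ∀ x m, P x → P (ExteriorAlgebra.ι K m * x)) (x : ExteriorAlgebra K V) : P x :=
  CliffordAlgebra.left_induction (P := P) (0 : QuadraticForm K V) algebraMap add ι_mul x

/-- The right action of the exterior algebra on `⋀V ⊗ V` extending `stepRight`. -/
def extRight (b : Module.Basis I K V) (p : K) :
    ExteriorAlgebra K V →ₐ[K] (Module.End K (ExteriorAlgebra K V ⊗[K] V))ᵐᵒᵖ :=
  ExteriorAlgebra.lift K ⟨(MulOpposite.opLinearEquiv K).toLinearMap ∘ₗ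
    stepRight (hecke b p) (ExteriorAlgebra.ι K), stepRight_sq b p⟩

theorem extRight_ι (b : Module.Basis I K V) (p : K) (w : V) :
    extRight b p (ExteriorAlgebra.ι K w) =
      MulOpposite.op (stepRight (hecke b p) (ExteriorAlgebra.ι K) w) := by
  rw [extRight, ExteriorAlgebra.lift_ι_apply]
  rfl

theorem extRight_mulLeft (b : Module.Basis I K V) (p : K) (t y : ExteriorAlgebra K V)
    (z : ExteriorAlgebra K V ⊗[K] V) :
    (extRight b p y).unop (LinearMap.rTensor V (LinearMap.mulLeft K t) z) =
      LinearMap.rTensor V (LinearMap.mulLeft K t) ((extRight b p y).unop z) := by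
  induction y using ExteriorAlgebra.induction generalizing z with
  | algebraMap r => simp [Algebra.algebraMap_eq_smul_one]
  | ι w =>
    rw [extRight_ι, MulOpposite.unop_op]
    induction z using TensorProduct.induction_on with
    | zero => simp
    | add x y hx hy => simp only [map_add, hx, hy]
    | tmul x v =>
      rw [LinearMap.rTensor_tmul, stepRight_apply, stepRight_apply]
      rw [LinearMap.mulLeft_apply, LinearMap.mulLeft_mul, LinearMap.comp_assoc,
        LinearMap.rTensor_comp, LinearMap.comp_apply]
  | mul x y hx hy => simp [hx, hy]
  | add x y hx hy => simp [hx, hy]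

/-- The crossing of a strand `V` over a strand `⋀V`. -/
def extCrossV (b : Module.Basis I K V) (p : K) :
    V ⊗[K] ExteriorAlgebra K V →ₗ[K] ExteriorAlgebra K V ⊗[K] V :=
  crossV (extRight b p)

theorem extCrossV_one (b : Module.Basis I K V) (p : K) (v : V) :
    extCrossV b p (v ⊗ₜ 1) = 1 ⊗ₜ v := by
  simp [extCrossV, crossV_apply]

theorem extCrossV_ι_mul (b : Module.Basis I K V) (p : K) (i k : I) (y : ExteriorAlgebra K V) :
    extCrossV b p (b i ⊗ₜ (ExteriorAlgebra.ι K (b k) * y)) =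
      (p ^ heaviside i k - 1) • LinearMap.rTensor V
        (LinearMap.mulLeft K (ExteriorAlgebra.ι K (b i))) (extCrossV b p (b k ⊗ₜ y)) -
      p ^ heaviside k i • LinearMap.rTensor V
        (LinearMap.mulLeft K (ExteriorAlgebra.ι K (b k))) (extCrossV b p (b i ⊗ₜ y)) := by
  simp only [extCrossV, crossV_apply, ← extRight_mulLeft, map_mul, MulOpposite.unop_mul,
    Module.End.mul_apply, extRight_ι, MulOpposite.unop_op, stepRight_apply, hecke_apply]
  simp

theorem stepLeft_ι_mul (b : Module.Basis I K V) (p : K) (i k : I)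
    (z : ExteriorAlgebra K V ⊗[K] ExteriorAlgebra K V) :
    stepLeft (extCrossV b p) (ExteriorAlgebra.ι K) (b i)
        (LinearMap.rTensor _ (LinearMap.mulLeft K (ExteriorAlgebra.ι K (b k))) z) =
      (p ^ heaviside i k - 1) • LinearMap.rTensor _
        (LinearMap.mulLeft K (ExteriorAlgebra.ι K (b i)))
          (stepLeft (extCrossV b p) (ExteriorAlgebra.ι K) (b k) z) -
      p ^ heaviside k i • LinearMap.rTensor _
        (LinearMap.mulLeft K (ExteriorAlgebra.ι K (b k)))
          (stepLeft (extCrossV b p) (ExteriorAlgebra.ι K) (b i) z) := by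
  induction z using TensorProduct.induction_on with
  | zero => simp
  | add x y hx hy => simp only [map_add, hx, hy, smul_add]; abel
  | tmul y t =>
    simp only [LinearMap.rTensor_tmul, stepLeft_apply, LinearMap.mulLeft_apply, extCrossV_ι_mul,
      map_sub, map_smul]
    simp only [lTensor_rTensor_comm]

theorem stepLeft_algebraMap (b : Module.Basis I K V) (p : K) (v : V) (r : K)
    (t : ExteriorAlgebra K V) :
    stepLeft (extCrossV b p) (ExteriorAlgebra.ι K) v (algebraMap K _ r ⊗ₜ t) =
      algebraMap K _ r ⊗ₜ (ExteriorAlgebra.ι K v * t) := by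
  rw [stepLeft_apply, Algebra.algebraMap_eq_smul_one, TensorProduct.tmul_smul, map_smul,
    extCrossV_one]
  simp [TensorProduct.smul_tmul']

theorem stepLeft_key (b : Module.Basis I K V) (p : K) (t y : ExteriorAlgebra K V) :
    ∀ i k : I,
      stepLeft (extCrossV b p) (ExteriorAlgebra.ι K) (b i)
          (stepLeft (extCrossV b p) (ExteriorAlgebra.ι K) (b k) (y ⊗ₜ t)) +
        stepLeft (extCrossV b p) (ExteriorAlgebra.ι K) (b k)
          (stepLeft (extCrossV b p) (ExteriorAlgebra.ι K) (b i) (y ⊗ₜ t)) = 0 ∧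
      stepLeft (extCrossV b p) (ExteriorAlgebra.ι K) (b i)
        (stepLeft (extCrossV b p) (ExteriorAlgebra.ι K) (b i) (y ⊗ₜ t)) = 0 := by
  induction y using ext_left_induction with
  | algebraMap r =>
    intro i k
    constructor
    · simp only [stepLeft_algebraMap]
      rw [← mul_assoc, ← mul_assoc, ← TensorProduct.tmul_add, ← add_mul,
        ExteriorAlgebra.ι_add_mul_swap, zero_mul, TensorProduct.tmul_zero]
    · simp only [stepLeft_algebraMap]
      rw [← mul_assoc, ExteriorAlgebra.ι_sq_zero, zero_mul, TensorProduct.tmul_zero]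
  | add x y hx hy =>
    intro i k
    simp only [TensorProduct.add_tmul, map_add]
    refine ⟨?_, by rw [(hx i k).2, (hy i k).2, add_zero]⟩
    rw [add_add_add_comm, (hx i k).1, (hy i k).1, add_zero]
  | ι_mul y m ih =>
    have hm : m ∈ Submodule.span K (Set.range b) := by simp [b.span_eq]
    intro i k
    induction hm using Submodule.span_induction with
    | mem x hx =>
      obtain ⟨l, rfl⟩ := hx
      have hr : (ExteriorAlgebra.ι K (b l) * y) ⊗ₜ[K] t = LinearMap.rTensor _
        (LinearMap.mulLeft K (ExteriorAlgebra.ι K (b l))) (y ⊗ₜ[K] t) := by simp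
      rw [hr]
      simp only [stepLeft_ι_mul, map_sub, map_smul]
      exact hecke_cancel_left p (fun u v w => LinearMap.rTensor _
        (LinearMap.mulLeft K (ExteriorAlgebra.ι K (b w)))
          (stepLeft (extCrossV b p) (ExteriorAlgebra.ι K) (b u)
            (stepLeft (extCrossV b p) (ExteriorAlgebra.ι K) (b v) (y ⊗ₜ t))))
        (fun u w => by rw [(ih u u).2, map_zero])
        (fun u v w => by rw [eq_neg_of_add_eq_zero_left (ih u v).1, map_neg]) i k l
    | zero => simp
    | add x y _ _ hx hy =>
      simp only [map_add, add_mul, TensorProduct.add_tmul]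
      refine ⟨?_, by rw [hx.2, hy.2, add_zero]⟩
      rw [add_add_add_comm, hx.1, hy.1, add_zero]
    | smul a x _ hx =>
      simp only [map_smul, smul_mul_assoc, ← TensorProduct.smul_tmul', ← smul_add, hx.1, hx.2,
        smul_zero, and_self]

theorem stepLeft_sq (b : Module.Basis I K V) (p : K) (v : V) :
    stepLeft (extCrossV b p) (ExteriorAlgebra.ι K) v *
      stepLeft (extCrossV b p) (ExteriorAlgebra.ι K) v = 0 := by
  have hB := alt_of_basis (N := Module.End K (ExteriorAlgebra K V ⊗[K] ExteriorAlgebra K V)) b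
    ((LinearMap.mul K (Module.End K (ExteriorAlgebra K V ⊗[K] ExteriorAlgebra K V))).compl₁₂
      (stepLeft (extCrossV b p) (ExteriorAlgebra.ι K))
      (stepLeft (extCrossV b p) (ExteriorAlgebra.ι K))) (fun i => ?_) (fun i k => ?_) v
  · simpa using hB
  · exact TensorProduct.ext' fun y t => (stepLeft_key b p t y i i).2
  · exact TensorProduct.ext' fun y t => (stepLeft_key b p t y i k).1

end Hecke

section Braidings

variable {K V I : Type*} [Field K] [AddCommGroup V] [Module K V] [LinearOrder I]

/-- The left action of the exterior algebra on `⋀V ⊗ ⋀V` extending `stepLeft`. -/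
def extLeft (b : Module.Basis I K V) (p : K) :
    ExteriorAlgebra K V →ₐ[K] Module.End K (ExteriorAlgebra K V ⊗[K] ExteriorAlgebra K V) :=
  ExteriorAlgebra.lift K ⟨stepLeft (extCrossV b p) (ExteriorAlgebra.ι K), stepLeft_sq b p⟩

/-- The braiding `τ̂` of `Λ_p(V)`, that is, of the exterior algebra of `V`: the map induced by
the Hecke-type braiding `τ` of `V`. It is the quotient of the braiding of the tensor algebra, see
`extBraiding_toExterior`. -/
def extBraiding (b : Module.Basis I K V) (p : K) :
    ExteriorAlgebra K V ⊗[K] ExteriorAlgebra K V →ₗ[K]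
      ExteriorAlgebra K V ⊗[K] ExteriorAlgebra K V :=
  crossA (extLeft b p)

/-- The right action of the tensor algebra on `T(V) ⊗ V` extending `stepRight`. -/
def tensorRight (τ : V ⊗[K] V →ₗ[K] V ⊗[K] V) :
    TensorAlgebra K V →ₐ[K] (Module.End K (TensorAlgebra K V ⊗[K] V))ᵐᵒᵖ :=
  TensorAlgebra.lift K ((MulOpposite.opLinearEquiv K).toLinearMap ∘ₗ
    stepRight τ (TensorAlgebra.ι K))

/-- The crossing of a strand `V` over a strand `T(V)`. -/
def tensorCrossV (τ : V ⊗[K] V →ₗ[K] V ⊗[K] V) :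
    V ⊗[K] TensorAlgebra K V →ₗ[K] TensorAlgebra K V ⊗[K] V :=
  crossV (tensorRight τ)

/-- The left action of the tensor algebra on `T(V) ⊗ T(V)` extending `stepLeft`. -/
def tensorLeft (τ : V ⊗[K] V →ₗ[K] V ⊗[K] V) :
    TensorAlgebra K V →ₐ[K] Module.End K (TensorAlgebra K V ⊗[K] TensorAlgebra K V) :=
  TensorAlgebra.lift K (stepLeft (tensorCrossV τ) (TensorAlgebra.ι K))

/-- The braiding of the tensor algebra `T(V)` induced by a braiding `τ` of `V`. -/
def tensorBraiding (τ : V ⊗[K] V →ₗ[K] V ⊗[K] V) :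
    TensorAlgebra K V ⊗[K] TensorAlgebra K V →ₗ[K] TensorAlgebra K V ⊗[K] TensorAlgebra K V :=
  crossA (tensorLeft τ)

theorem tensorRight_ι (τ : V ⊗[K] V →ₗ[K] V ⊗[K] V) (w : V) :
    tensorRight τ (TensorAlgebra.ι K w) =
      MulOpposite.op (stepRight τ (TensorAlgebra.ι K) w) := by
  rw [tensorRight, TensorAlgebra.lift_ι_apply]
  rfl

theorem tensorLeft_ι (τ : V ⊗[K] V →ₗ[K] V ⊗[K] V) (w : V) :
    tensorLeft τ (TensorAlgebra.ι K w) = stepLeft (tensorCrossV τ) (TensorAlgebra.ι K) w := by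
  rw [tensorLeft, TensorAlgebra.lift_ι_apply]

theorem tensorRight_mulLeft (τ : V ⊗[K] V →ₗ[K] V ⊗[K] V) (t y : TensorAlgebra K V)
    (z : TensorAlgebra K V ⊗[K] V) :
    (tensorRight τ y).unop (LinearMap.rTensor V (LinearMap.mulLeft K t) z) =
      LinearMap.rTensor V (LinearMap.mulLeft K t) ((tensorRight τ y).unop z) := by
  induction y using TensorAlgebra.induction generalizing z with
  | algebraMap r => simp [Algebra.algebraMap_eq_smul_one]
  | ι w =>
    rw [tensorRight_ι, MulOpposite.unop_op]
    induction z using TensorProduct.induction_on with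
    | zero => simp
    | add x y hx hy => simp only [map_add, hx, hy]
    | tmul x v =>
      rw [LinearMap.rTensor_tmul, stepRight_apply, stepRight_apply]
      rw [LinearMap.mulLeft_apply, LinearMap.mulLeft_mul, LinearMap.comp_assoc,
        LinearMap.rTensor_comp, LinearMap.comp_apply]
  | mul x y hx hy => simp [hx, hy]
  | add x y hx hy => simp [hx, hy]

theorem tensorLeft_mulRight (τ : V ⊗[K] V →ₗ[K] V ⊗[K] V) (t x : TensorAlgebra K V)
    (z : TensorAlgebra K V ⊗[K] TensorAlgebra K V) :
    tensorLeft τ x (LinearMap.lTensor _ (LinearMap.mulRight K t) z) =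
      LinearMap.lTensor _ (LinearMap.mulRight K t) (tensorLeft τ x z) := by
  induction x using TensorAlgebra.induction generalizing z with
  | algebraMap r => simp [Algebra.algebraMap_eq_smul_one]
  | ι w =>
    rw [tensorLeft_ι]
    induction z using TensorProduct.induction_on with
    | zero => simp
    | add x y hx hy => simp only [map_add, hx, hy]
    | tmul x v =>
      rw [LinearMap.lTensor_tmul, stepLeft_apply, stepLeft_apply]
      rw [LinearMap.mulRight_apply, LinearMap.mulRight_mul, LinearMap.comp_assoc,
        LinearMap.lTensor_comp, LinearMap.comp_apply]
  | mul x y hx hy => simp [hx, hy]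
  | add x y hx hy => simp [hx, hy]

/-- The braiding of `T(V)` is compatible with the unit. -/
theorem tensorBraiding_one_tmul (τ : V ⊗[K] V →ₗ[K] V ⊗[K] V) (y : TensorAlgebra K V) :
    tensorBraiding τ (1 ⊗ₜ y) = y ⊗ₜ 1 := by
  simp [tensorBraiding, crossA_apply]

theorem tensorBraiding_tmul_one (τ : V ⊗[K] V →ₗ[K] V ⊗[K] V) (x : TensorAlgebra K V) :
    tensorBraiding τ (x ⊗ₜ 1) = 1 ⊗ₜ x := by
  rw [tensorBraiding, crossA_apply]
  suffices h : ∀ t, tensorLeft τ x (1 ⊗ₜ t) = 1 ⊗ₜ (x * t) by rw [h, mul_one]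
  induction x using TensorAlgebra.induction with
  | algebraMap r => intro t; simp [Algebra.algebraMap_eq_smul_one]
  | ι v => intro t; simp [tensorLeft_ι, stepLeft_apply, tensorCrossV, crossV_apply]
  | mul x y hx hy => intro t; simp [hx, hy, mul_assoc]
  | add x y hx hy => intro t; simp [hx, hy, add_mul, TensorProduct.tmul_add]

/-- The braiding of `T(V)` restricts to `τ` on `V ⊗ V`. -/
theorem tensorBraiding_ι_tmul_ι (τ : V ⊗[K] V →ₗ[K] V ⊗[K] V) (v w : V) :
    tensorBraiding τ (TensorAlgebra.ι K v ⊗ₜ TensorAlgebra.ι K w) =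
      TensorProduct.map (TensorAlgebra.ι K) (TensorAlgebra.ι K) (τ (v ⊗ₜ w)) := by
  rw [tensorBraiding, crossA_apply, tensorLeft_ι, stepLeft_apply, tensorCrossV, crossV_apply,
    tensorRight_ι, MulOpposite.unop_op, stepRight_apply]
  induction τ (v ⊗ₜ w) using TensorProduct.induction_on with
  | zero => simp
  | add x y hx hy => simp only [map_add, hx, hy]
  | tmul x t => simp

/-- The braiding of `T(V)` is compatible with the product of the left strand:
`τ̂ (∇ ⊗ id) = (id ⊗ ∇) (τ̂ ⊗ id) (id ⊗ τ̂)`. -/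
theorem tensorBraiding_mul_tmul (τ : V ⊗[K] V →ₗ[K] V ⊗[K] V) (x y z : TensorAlgebra K V) :
    tensorBraiding τ ((x * y) ⊗ₜ z) =
      LinearMap.lTensor _ (LinearMap.mul' K _) (TensorProduct.assoc K _ _ _
        (LinearMap.rTensor _ (tensorBraiding τ) ((TensorProduct.assoc K _ _ _).symm
          (x ⊗ₜ tensorBraiding τ (y ⊗ₜ z))))) := by
  simp only [tensorBraiding, crossA_apply, map_mul, Module.End.mul_apply]
  induction tensorLeft τ y (z ⊗ₜ 1) using TensorProduct.induction_on with
  | zero => simp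
  | add u v hu hv => simp only [map_add, hu, hv, TensorProduct.tmul_add]
  | tmul u w =>
    have h : u ⊗ₜ[K] w = LinearMap.lTensor _ (LinearMap.mulRight K w) (u ⊗ₜ[K] 1) := by simp
    rw [h, tensorLeft_mulRight, ← h]
    simp only [TensorProduct.assoc_symm_tmul, LinearMap.rTensor_tmul, crossA_apply]
    induction tensorLeft τ x (u ⊗ₜ 1) using TensorProduct.induction_on with
    | zero => simp
    | add u v hu hv => simp only [map_add, hu, hv, TensorProduct.add_tmul]
    | tmul u w => simp

/-- The map `a ⊗ c ↦ a · (F c ζ)`. -/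
def hexAct (τ : V ⊗[K] V →ₗ[K] V ⊗[K] V) (ζ : TensorAlgebra K V ⊗[K] TensorAlgebra K V) :
    TensorAlgebra K V ⊗[K] TensorAlgebra K V →ₗ[K] TensorAlgebra K V ⊗[K] TensorAlgebra K V :=
  LinearMap.rTensor _ (LinearMap.mul' K _) ∘ₗ
    (TensorProduct.assoc K _ _ _).symm.toLinearMap ∘ₗ
      LinearMap.lTensor _ ((tensorLeft τ).toLinearMap.flip ζ)

theorem hexAct_tmul (τ : V ⊗[K] V →ₗ[K] V ⊗[K] V)
    (ζ : TensorAlgebra K V ⊗[K] TensorAlgebra K V) (a c : TensorAlgebra K V) :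
    hexAct τ ζ (a ⊗ₜ c) = LinearMap.rTensor _ (LinearMap.mulLeft K a) (tensorLeft τ c ζ) := by
  simp only [hexAct, LinearMap.comp_apply, LinearMap.lTensor_tmul, LinearMap.flip_apply,
    AlgHom.toLinearMap_apply, LinearEquiv.coe_coe]
  induction tensorLeft τ c ζ using TensorProduct.induction_on with
  | zero => simp
  | add u v hu hv => simp only [map_add, hu, hv, TensorProduct.tmul_add]
  | tmul u w => simp

theorem hexAct_mulRight (τ : V ⊗[K] V →ₗ[K] V ⊗[K] V)
    (ζ s : TensorAlgebra K V ⊗[K] TensorAlgebra K V) (c : TensorAlgebra K V) :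
    hexAct τ ζ (LinearMap.lTensor _ (LinearMap.mulRight K c) s) =
      hexAct τ (tensorLeft τ c ζ) s := by
  induction s using TensorProduct.induction_on with
  | zero => simp
  | add u v hu hv => simp only [map_add, hu, hv]
  | tmul u w => simp [hexAct_tmul]

theorem tensorLeft_mulLeft (τ : V ⊗[K] V →ₗ[K] V ⊗[K] V) (x u : TensorAlgebra K V)
    (ζ : TensorAlgebra K V ⊗[K] TensorAlgebra K V) :
    tensorLeft τ x (LinearMap.rTensor _ (LinearMap.mulLeft K u) ζ) =
      hexAct τ ζ (tensorLeft τ x (u ⊗ₜ 1)) := by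
  induction x using TensorAlgebra.induction generalizing u ζ with
  | algebraMap r => simp [Algebra.algebraMap_eq_smul_one, hexAct_tmul]
  | ι v =>
    rw [tensorLeft_ι, stepLeft_apply]
    induction ζ using TensorProduct.induction_on with
    | zero => simp [hexAct]
    | add y z hy hz =>
      rw [map_add, map_add, hy, hz]
      simp [hexAct]
    | tmul y t =>
      rw [LinearMap.rTensor_tmul, stepLeft_apply, LinearMap.mulLeft_apply, tensorCrossV,
        crossV_apply, crossV_apply, map_mul, MulOpposite.unop_mul, Module.End.mul_apply]
      induction (tensorRight τ u).unop (1 ⊗ₜ v) using TensorProduct.induction_on with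
      | zero => simp
      | add y z hy hz => simp only [map_add, hy, hz]
      | tmul a w =>
        have h : a ⊗ₜ[K] w = LinearMap.rTensor _ (LinearMap.mulLeft K a) (1 ⊗ₜ[K] w) := by simp
        rw [h, tensorRight_mulLeft, ← h, lTensor_rTensor_comm, LinearMap.lTensor_tmul,
          hexAct_tmul, LinearMap.comp_apply, LinearMap.mulRight_apply, mul_one, tensorLeft_ι,
          stepLeft_apply, tensorCrossV, crossV_apply]
  | mul x x' hx hx' =>
    rw [map_mul, Module.End.mul_apply, Module.End.mul_apply, hx']
    induction tensorLeft τ x' (u ⊗ₜ 1) using TensorProduct.induction_on with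
    | zero => simp
    | add y z hy hz => simp only [map_add, hy, hz]
    | tmul a c =>
      have h : a ⊗ₜ[K] c = LinearMap.lTensor _ (LinearMap.mulRight K c) (a ⊗ₜ[K] 1) := by simp
      rw [hexAct_tmul, hx, h, tensorLeft_mulRight, hexAct_mulRight]
  | add x y hx hy => simp [hx, hy]

/-- The braiding of `T(V)` is compatible with the product of the right strand:
`τ̂ (id ⊗ ∇) = (∇ ⊗ id) (id ⊗ τ̂) (τ̂ ⊗ id)`. -/
theorem tensorBraiding_tmul_mul (τ : V ⊗[K] V →ₗ[K] V ⊗[K] V) (x y z : TensorAlgebra K V) :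
    tensorBraiding τ (x ⊗ₜ (y * z)) =
      LinearMap.rTensor _ (LinearMap.mul' K _) ((TensorProduct.assoc K _ _ _).symm
        (LinearMap.lTensor _ (tensorBraiding τ) (TensorProduct.assoc K _ _ _
          (tensorBraiding τ (x ⊗ₜ y) ⊗ₜ z)))) := by
  have h : (y * z) ⊗ₜ[K] (1 : TensorAlgebra K V) =
    LinearMap.rTensor _ (LinearMap.mulLeft K y) (z ⊗ₜ[K] 1) := by simp
  rw [tensorBraiding, crossA_apply, crossA_apply, h, tensorLeft_mulLeft]
  induction tensorLeft τ x (y ⊗ₜ 1) using TensorProduct.induction_on with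
  | zero => simp
  | add y z hy hz => simp only [map_add, hy, hz, TensorProduct.add_tmul]
  | tmul a c => simp [hexAct, crossA_apply]

theorem extLeft_ι (b : Module.Basis I K V) (p : K) (w : V) :
    extLeft b p (ExteriorAlgebra.ι K w) =
      stepLeft (extCrossV b p) (ExteriorAlgebra.ι K) w := by
  rw [extLeft, ExteriorAlgebra.lift_ι_apply]

theorem extRight_toExterior (b : Module.Basis I K V) (p : K) (y : TensorAlgebra K V)
    (z : TensorAlgebra K V ⊗[K] V) :
    (extRight b p (TensorAlgebra.toExterior y)).unop
        (LinearMap.rTensor V TensorAlgebra.toExterior.toLinearMap z) =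
      LinearMap.rTensor V TensorAlgebra.toExterior.toLinearMap
        ((tensorRight (hecke b p) y).unop z) := by
  induction y using TensorAlgebra.induction generalizing z with
  | algebraMap r => simp [Algebra.algebraMap_eq_smul_one]
  | ι w =>
    rw [TensorAlgebra.toExterior_ι, extRight_ι, tensorRight_ι, MulOpposite.unop_op,
      MulOpposite.unop_op]
    induction z using TensorProduct.induction_on with
    | zero => simp
    | add x y hx hy => simp only [map_add, hx, hy]
    | tmul x v =>
      rw [LinearMap.rTensor_tmul, stepRight_apply, stepRight_apply]
      induction hecke b p (v ⊗ₜ w) using TensorProduct.induction_on with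
      | zero => simp
      | add x y hx hy => simp only [map_add, hx, hy]
      | tmul x t => simp
  | mul x y hx hy => simp [hx, hy]
  | add x y hx hy => simp [hx, hy]

theorem extCrossV_toExterior (b : Module.Basis I K V) (p : K) (v : V) (y : TensorAlgebra K V) :
    extCrossV b p (v ⊗ₜ TensorAlgebra.toExterior y) =
      LinearMap.rTensor V TensorAlgebra.toExterior.toLinearMap
        (tensorCrossV (hecke b p) (v ⊗ₜ y)) := by
  rw [extCrossV, tensorCrossV, crossV_apply, crossV_apply, ← extRight_toExterior]
  simp

theorem extLeft_toExterior (b : Module.Basis I K V) (p : K) (x : TensorAlgebra K V)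
    (z : TensorAlgebra K V ⊗[K] TensorAlgebra K V) :
    extLeft b p (TensorAlgebra.toExterior x)
        (TensorProduct.map TensorAlgebra.toExterior.toLinearMap
          TensorAlgebra.toExterior.toLinearMap z) =
      TensorProduct.map TensorAlgebra.toExterior.toLinearMap
        TensorAlgebra.toExterior.toLinearMap (tensorLeft (hecke b p) x z) := by
  induction x using TensorAlgebra.induction generalizing z with
  | algebraMap r => simp [Algebra.algebraMap_eq_smul_one]
  | ι w =>
    rw [TensorAlgebra.toExterior_ι, extLeft_ι, tensorLeft_ι]
    induction z using TensorProduct.induction_on with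
    | zero => simp
    | add x y hx hy => simp only [map_add, hx, hy]
    | tmul x t =>
      rw [TensorProduct.map_tmul, stepLeft_apply, stepLeft_apply]
      simp only [AlgHom.toLinearMap_apply]
      rw [extCrossV_toExterior]
      induction tensorCrossV (hecke b p) (w ⊗ₜ x) using TensorProduct.induction_on with
      | zero => simp
      | add x y hx hy => simp only [map_add, hx, hy]
      | tmul x t => simp
  | mul x y hx hy => simp [hx, hy]
  | add x y hx hy => simp [hx, hy]

/-- The braiding of the exterior algebra is the quotient of the braiding of the tensor algebra. -/
theorem extBraiding_toExterior (b : Module.Basis I K V) (p : K) (x y : TensorAlgebra K V) :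
    extBraiding b p (TensorAlgebra.toExterior x ⊗ₜ TensorAlgebra.toExterior y) =
      TensorProduct.map TensorAlgebra.toExterior.toLinearMap
        TensorAlgebra.toExterior.toLinearMap (tensorBraiding (hecke b p) (x ⊗ₜ y)) := by
  rw [extBraiding, tensorBraiding, crossA_apply, crossA_apply, ← extLeft_toExterior]
  simp

end Braidings

section SetBasis

variable {K V I : Type*} [Field K] [AddCommGroup V] [Module K V] [LinearOrder I]

/-- The element `f_E` of the set-theoretic basis of the exterior algebra: the product of the
elements of `E` in increasing order. -/
def setVec (b : Module.Basis I K V) (E : Finset I) : ExteriorAlgebra K V := b.ExteriorAlgebra E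

/-- The basis `f_{E,F} = f_E ⊗ f_F` of `⋀V ⊗ ⋀V`. -/
def setBasis (b : Module.Basis I K V) :
    Module.Basis (Finset I × Finset I) K (ExteriorAlgebra K V ⊗[K] ExteriorAlgebra K V) :=
  b.ExteriorAlgebra.tensorProduct b.ExteriorAlgebra

theorem setBasis_apply (b : Module.Basis I K V) (E F : Finset I) :
    setBasis b (E, F) = setVec b E ⊗ₜ setVec b F :=
  Module.Basis.tensorProduct_apply _ _ _ _

theorem setVec_eq_prod (b : Module.Basis I K V) (E : Finset I) :
    setVec b E = ((E.sort (· ≤ ·)).map fun i => ExteriorAlgebra.ι K (b i)).prod := by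
  have h : (E.sort (· ≤ ·)).map (fun i => ExteriorAlgebra.ι K (b i)) =
      List.ofFn fun i : Fin E.card => ExteriorAlgebra.ι K (b (E.orderEmbOfFin rfl i)) := by
    apply List.ext_getElem
    · simp
    · intro n h1 h2
      simp [Finset.orderEmbOfFin_apply]
  rw [h, setVec, ExteriorAlgebra.basis_apply]
  exact ExteriorAlgebra.ιMulti_apply _

/-- The set obtained from `E` by giving away `G` and receiving `H`: `(E \ G) ∪ H`. -/
def exchange (E G H : Finset I) : Finset I := (E \ G) ∪ H

/-- The matrix coefficient `s_{E,G;F,H}`: up to the sign `(-1)^{|E||F|}`, it is the coefficient of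
`f_{F',E'}` in `τ̂ f_{E,F}`, where `E' = (E \ G) ∪ H` and `F' = (F \ H) ∪ G`. -/
def exchangeCoeff (b : Module.Basis I K V) (p : K) (E G F H : Finset I) : K :=
  (-1) ^ (E.card * F.card) *
    (setBasis b).repr (extBraiding b p (setVec b E ⊗ₜ setVec b F)) (exchange F H G, exchange E G H)

/-- The size-`k` exchange channel `τ_k` of the braiding:
`τ_k f_{E,F} = (-1)^{|E||F|} ∑ s_{E,G;F,H} f_{F',E'}`, the sum being over the `k`-element subsets
`G` of `E \ F` and `H` of `F \ E`. -/
def channel (b : Module.Basis I K V) (p : K) (k : ℕ) :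
    ExteriorAlgebra K V ⊗[K] ExteriorAlgebra K V →ₗ[K]
      ExteriorAlgebra K V ⊗[K] ExteriorAlgebra K V :=
  (setBasis b).constr K fun x =>
    (-1 : K) ^ (x.1.card * x.2.card) •
      ∑ G ∈ (x.1 \ x.2).powersetCard k, ∑ H ∈ (x.2 \ x.1).powersetCard k,
        exchangeCoeff b p x.1 G x.2 H • (setVec b (exchange x.2 H G) ⊗ₜ[K] setVec b (exchange x.1 G H))

/-- `α_{G,H} = ∏ (p^{θ_{A,H} - θ_{A,G}} - 1)`, over the one-element subsets `A` of `G`. -/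
def alpha (p : K) (G H : Finset I) : K :=
  ∏ A ∈ G.powersetCard 1, (p ^ ((theta A H : ℤ) - (theta A G : ℤ)) - 1)

/-- `β_{E,G;F,H} = (-1)^{θ_{F,E} + θ_{F',E'}} p^{θ_{G ⊔ C,E} + θ_{Ḟ,E'}} α_{G,H}`, where
`C = E ∩ F`, `Ḟ = (F \ E) \ H`, `E' = (E \ G) ∪ H` and `F' = (F \ H) ∪ G`. -/
def beta (p : K) (E G F H : Finset I) : K :=
  (-1) ^ (theta F E + theta (exchange F H G) (exchange E G H)) *
    p ^ (theta (G ∪ (E ∩ F)) E + theta ((F \ E) \ H) (exchange E G H)) * alpha p G H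

end SetBasis

end DeformedExterior

end

open scoped TensorProduct

noncomputable section

namespace DeformedExterior

/-! ### Additivity and reflection of the counting function θ -/

section Theta

variable {I : Type*} [LinearOrder I]

/-! All three claims come from a closed form, `braidCoeff`, for every matrix coefficient of τ̂ in
the basis f_{X,Y}. It is established in `repr_extBraiding` by induction on E, adjoining a new
smallest element a. Since f_{E ∪ {a}} = a f_E, fusion says that the vector a crosses last: the
coefficients for E ∪ {a} arise from those for E by moving a across the left factor of each f_{P,Q}
that occurs.

While crossing f_P, the vector a meets the elements of P in increasing order. It either passes
through all of them or is exchanged with a single h < a. After such an exchange h travels on and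
meets only larger elements, so no second exchange occurs (`extCrossV_setVec`). In coordinates this
is the recursion `repr_stepLeft`, and `braidCoeff_insert` shows that the closed form obeys it. The
exchange terms telescope: ∑ (p - 1) p^{θ_{h,Y}} over h ∈ Y with h < a is p^{θ_{a,Y}} - 1. If a ∉ Y,
this is the new factor of the product α. If a lies in both X and Y, it enters with a minus sign and
cancels against the weight p^{θ_{a,Y}} of the pass-through term, leaving 1. If a ∈ Y \ X, only the
pass-through term is present.

The closed form is supported on pairs with X + Y = E + F as multisets and |Y| = |E|. Such a pair
determines G = E \ Y and H = Y \ E, which have equal size; this gives the channel decomposition, and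
substituting X = F', Y = E' gives β.

Non-vanishing is a discrete intermediate value argument (`alpha_ne_zero_iff`). Along G in increasing
order, θ_{g,H} - θ_{g,G} starts at a nonnegative value and drops by at most 1 per step, so it cannot
become negative without vanishing; where it vanishes, so does a factor of α. Genericity is needed
only to see that positive exponents give nonzero factors. -/

theorem theta_empty_left (B : Finset I) : theta ∅ B = 0 := by simp [theta]

theorem theta_empty_right (A : Finset I) : theta A ∅ = 0 := by simp [theta]

theorem theta_insert_left {a : I} {A : Finset I} (h : a ∉ A) (B : Finset I) :
    theta (insert a A) B = theta {a} B + theta A B := by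
  simp [theta, Finset.sum_insert h]

theorem theta_insert_right {c : I} {B : Finset I} (h : c ∉ B) (A : Finset I) :
    theta A (insert c B) = theta A {c} + theta A B := by
  simp [theta, Finset.sum_insert h, Finset.sum_add_distrib]

theorem theta_sdiff_add_inter (A B E : Finset I) :
    theta A B = theta (E ∩ A) B + theta (A \ E) B := by
  rw [Finset.inter_comm]
  simp only [theta]
  exact (Finset.sum_inter_add_sum_sdiff A E _).symm

theorem theta_singleton_left (a : I) (B : Finset I) :
    theta {a} B = (B.filter (· < a)).card := by
  rw [Finset.card_filter]
  simp only [theta, heaviside, Finset.sum_singleton]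

theorem theta_singleton_right (a : I) (B : Finset I) :
    theta B {a} = (B.filter (a < ·)).card := by
  rw [Finset.card_filter]
  simp only [theta, heaviside, Finset.sum_singleton]

theorem theta_singleton_singleton {a c : I} (h : c < a) : theta {a} {c} = 1 := by
  simp only [theta, heaviside, Finset.sum_singleton, if_pos h]

theorem theta_singleton_self (a : I) : theta {a} {a} = 0 := by
  simp [theta, heaviside]

theorem theta_singleton_left_of_lt {a : I} {B : Finset I} (h : ∀ x ∈ B, a < x) :
    theta {a} B = 0 := by
  rw [theta_singleton_left, Finset.card_eq_zero, Finset.filter_eq_empty_iff]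
  exact fun x hx => (h x hx).not_gt

theorem theta_singleton_right_of_lt {a : I} {B : Finset I} (h : ∀ x ∈ B, a < x) :
    theta B {a} = B.card := by
  rw [theta_singleton_right, Finset.filter_true_of_mem h]

theorem theta_singleton_swap {a : I} {B : Finset I} (h : a ∉ B) :
    theta {a} B + theta B {a} = B.card := by
  rw [theta_singleton_left, theta_singleton_right,
    ← Finset.card_filter_add_card_filter_not (s := B) (· < a)]
  congr 2
  refine Finset.filter_congr fun x hx => ?_
  have : a ≠ x := fun e => h (e ▸ hx)
  rw [not_lt]
  exact ⟨le_of_lt, fun h => lt_of_le_of_ne h this⟩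

/-- Every element of B is below, above or equal to a. The equality case is the source of the sign
that separates a ∈ F from a ∉ F in the recursion. -/
theorem theta_singleton_swap_add_ite (a : I) (B : Finset I) :
    theta {a} B + theta B {a} + (if a ∈ B then 1 else 0) = B.card := by
  split_ifs with h
  · have h' := theta_singleton_swap (Finset.notMem_erase a B)
    rw [← Finset.insert_erase h, theta_insert_left (Finset.notMem_erase a B),
      theta_insert_right (Finset.notMem_erase a B), theta_singleton_self,
      Finset.card_insert_of_notMem (Finset.notMem_erase a B)]
    omega
  · rw [theta_singleton_swap h, add_zero]

/-- θ depends additively on the multiset underlying its argument, so the conservation law of an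
exchange turns into a linear relation between values of θ. With its mirror image it supplies the
nontrivial input of the sign computations. -/
theorem theta_add_left {E F X Y : Finset I} (h : X.val + Y.val = E.val + F.val) (B : Finset I) :
    theta X B + theta Y B = theta E B + theta F B := by
  have := congrArg (fun m => (m.map fun a => ∑ c ∈ B, heaviside a c).sum) h
  simp only [Multiset.map_add, Multiset.sum_add] at this
  exact this

theorem theta_comm_sum (A B : Finset I) : theta A B = ∑ c ∈ B, ∑ a ∈ A, heaviside a c :=
  Finset.sum_comm

theorem theta_add_right {E F X Y : Finset I} (h : X.val + Y.val = E.val + F.val) (B : Finset I) :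
    theta B X + theta B Y = theta B E + theta B F := by
  have := congrArg (fun m => (m.map fun c => ∑ a ∈ B, heaviside a c).sum) h
  simp only [Multiset.map_add, Multiset.sum_add] at this
  simp only [theta_comm_sum]
  exact this

/-- The telescoping sum `∑_{h ∈ S} (p - 1) p^{#{s ∈ S | s < h}} = p^{|S|} - 1`. -/
theorem sum_sub_one_mul_pow_theta {K : Type*} [Field K] (p : K) (S : Finset I) :
    ∑ h ∈ S, (p - 1) * p ^ theta {h} S = p ^ S.card - 1 := by
  induction S using Finset.induction_on_max with
  | empty => simp
  | insert a S hS ih =>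
    have ha : a ∉ S := fun h => lt_irrefl _ (hS a h)
    rw [Finset.sum_insert ha, Finset.card_insert_of_notMem ha, theta_insert_right ha,
      theta_singleton_self, theta_singleton_left, Finset.filter_true_of_mem hS]
    -- The new maximum a is below no element of S, so the exponents of the old terms do not change.
    have : ∑ h ∈ S, (p - 1) * p ^ theta {h} (insert a S) =
        ∑ h ∈ S, (p - 1) * p ^ theta {h} S := by
      refine Finset.sum_congr rfl fun h hh => ?_
      rw [theta_insert_right ha, theta_singleton_left_of_lt (a := h) (B := {a}), zero_add]
      simpa using hS h hh
    rw [this, ih]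
    ring

/-- Reduces sign identities to parity statements in linear arithmetic. -/
theorem neg_one_pow_congr_mod {K : Type*} [Ring K] {m n : ℕ} (h : m % 2 = n % 2) :
    (-1 : K) ^ m = (-1) ^ n := by
  rw [neg_one_pow_eq_pow_mod_two, h, ← neg_one_pow_eq_pow_mod_two]

end Theta

/-! ### The closed form of the coefficients and its support -/

section Coefficient

variable {K I : Type*} [Field K]

/-- The finite sets `X`, `Y` arise from `F`, `E` by an exchange of equally many elements. -/
def IsExchange (E F X Y : Finset I) : Prop :=
  X.val + Y.val = E.val + F.val ∧ Y.card = E.card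

theorem IsExchange.card {E F X Y : Finset I} (h : IsExchange E F X Y) : X.card = F.card := by
  have := congrArg Multiset.card h.1
  have h2 := h.2
  simp only [Multiset.card_add, Finset.card_val] at this
  omega

variable [LinearOrder I]

/-- The factor of `braidCoeff` coming from the elements that `E` gives away. -/
def braidWeight (p : K) (E Y : Finset I) : K :=
  ∏ g ∈ E \ Y, (p ^ ((theta {g} Y : ℤ) - (theta {g} E : ℤ)) - 1)

open Classical in
/-- The coefficient of `f_{X,Y}` in `τ̂ f_{E,F}`, in closed form. -/
def braidCoeff (p : K) (E F X Y : Finset I) : K :=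
  if IsExchange E F X Y then
    (-1) ^ (E.card * F.card + theta F E + theta X Y) *
      p ^ (theta (E ∩ X) E + theta (X \ E) Y) * braidWeight p E Y
  else 0

theorem IsExchange.count {E F X Y : Finset I} (h : IsExchange E F X Y) (x : I) :
    (if x ∈ X then 1 else 0) + (if x ∈ Y then 1 else 0) =
      (if x ∈ E then 1 else 0) + (if x ∈ F then 1 else 0) := by
  have := congrArg (Multiset.count x) h.1
  simpa [Multiset.count_add, Multiset.count_eq_of_nodup, Finset.nodup] using this

theorem IsExchange.mem_left {E F X Y : Finset I} (h : IsExchange E F X Y) {x : I}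
    (hx : x ∉ E) (hy : x ∈ Y) : x ∉ X ∧ x ∈ F := by
  have := h.count x
  simp only [hx, hy, if_true, if_false] at this
  split_ifs at this <;> simp_all

theorem isExchange_erase {a : I} {E F X Y : Finset I} (ha : a ∉ E) (hY : a ∈ Y) :
    IsExchange E F X (Y.erase a) ↔ IsExchange (insert a E) F X Y := by
  unfold IsExchange
  rw [Finset.card_erase_of_mem hY, Finset.card_insert_of_notMem ha,
    Finset.insert_val_of_notMem ha]
  have e : Y.val = a ::ₘ (Y.erase a).val := by
    rw [← Finset.insert_val_of_notMem (Finset.notMem_erase a Y), Finset.insert_erase hY]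
  rw [e, Multiset.add_cons, Multiset.cons_add, Multiset.cons_inj_right]
  have := Finset.card_pos.2 ⟨a, hY⟩
  refine and_congr Iff.rfl ?_
  omega

/-- Returning a to the left argument and h to the right one changes both multiset sums by a single
element, which cancels. With the preceding lemma, this shows that the recursion never leaves the
support of the closed form. -/
theorem isExchange_swap {a h : I} {E F X Y : Finset I} (ha : a ∉ E) (hX : a ∈ X) (hY : h ∈ Y)
    (hX' : h ∉ X) :
    IsExchange E F (insert h (X.erase a)) (Y.erase h) ↔ IsExchange (insert a E) F X Y := by
  unfold IsExchange
  have h1 : h ∉ X.erase a := fun e => hX' (Finset.mem_of_mem_erase e)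
  rw [Finset.card_erase_of_mem hY, Finset.card_insert_of_notMem ha,
    Finset.insert_val_of_notMem ha, Finset.insert_val_of_notMem h1]
  have e : Y.val = h ::ₘ (Y.erase h).val := by
    rw [← Finset.insert_val_of_notMem (Finset.notMem_erase h Y), Finset.insert_erase hY]
  have e' : X.val = a ::ₘ (X.erase a).val := by
    rw [← Finset.insert_val_of_notMem (Finset.notMem_erase a X), Finset.insert_erase hX]
  rw [e, e', Multiset.add_cons, Multiset.cons_add, Multiset.cons_add, Multiset.cons_add,
    Multiset.cons_swap h a, Multiset.cons_inj_right]
  have := Finset.card_pos.2 ⟨h, hY⟩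
  refine and_congr Iff.rfl ?_
  omega

/-- Every g ∈ E is larger than a, hence than h. Removing h from Y and a from the first set lowers
both counts below g by 1, so the exponents, being differences, are unchanged; only the factor of a
can be new. -/
theorem braidWeight_erase (p : K) {a h : I} {E Y : Finset I} (hE : ∀ x ∈ E, a < x) (hY : h ∈ Y)
    (hh : h ≤ a) :
    braidWeight p E (Y.erase h) =
      ∏ g ∈ (insert a E \ Y).erase a,
        (p ^ ((theta {g} Y : ℤ) - (theta {g} (insert a E) : ℤ)) - 1) := by
  have ha : a ∉ E := fun h => lt_irrefl _ (hE a h)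
  have hset : E \ Y.erase h = (insert a E \ Y).erase a := by
    ext x
    simp only [Finset.mem_sdiff, Finset.mem_erase, Finset.mem_insert]
    grind
  rw [braidWeight, hset]
  refine Finset.prod_congr rfl fun g hg => ?_
  have hgE : g ∈ E := by grind
  have hag := hE g hgE
  have t1 : theta {g} Y = 1 + theta {g} (Y.erase h) := by
    conv_lhs => rw [← Finset.insert_erase hY]
    rw [theta_insert_right (Finset.notMem_erase h Y), theta_singleton_singleton (hh.trans_lt hag)]
  have t2 : theta {g} (insert a E) = 1 + theta {g} E := by
    rw [theta_insert_right ha, theta_singleton_singleton hag]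
  rw [t1, t2]
  push_cast
  congr 2
  ring

end Coefficient

/-! ### The closed form under adjoining a smallest element -/

section Recursion

variable {K I : Type*} [Field K] [LinearOrder I]

/-- The pass-through term of the recursion, written with the sign and power of p of the target
coefficient factored out. What remains is p^{θ_{a,Y}} if a also lies in X, and 1 otherwise. -/
theorem braidCoeff_erase (p : K) {a : I} {E F X Y : Finset I} (hE : ∀ x ∈ E, a < x)
    (hv : IsExchange (insert a E) F X Y) (hY : a ∈ Y) :
    (-1) ^ (X.card + theta {a} (Y.erase a)) * p ^ theta X {a} * braidCoeff p E F X (Y.erase a) =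
      (-1) ^ ((insert a E).card * F.card + theta F (insert a E) + theta X Y) *
        p ^ (theta (insert a E ∩ X) (insert a E) + theta (X \ insert a E) Y) *
        (p ^ (if a ∈ X then theta {a} Y else 0) * ∏ g ∈ (insert a E \ Y).erase a,
          (p ^ ((theta {g} Y : ℤ) - (theta {g} (insert a E) : ℤ)) - 1)) := by
  have ha : a ∉ E := fun h => lt_irrefl _ (hE a h)
  rw [braidCoeff, if_pos ((isExchange_erase ha hY).2 hv), braidWeight_erase p hE hY le_rfl]
  have hY0 : a ∉ Y.erase a := Finset.notMem_erase a Y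
  have hYe : Y = insert a (Y.erase a) := (Finset.insert_erase hY).symm
  set Y₀ := Y.erase a with hY₀
  have yB : ∀ B, theta B Y = theta B {a} + theta B Y₀ := fun B => by
    rw [hYe, theta_insert_right hY0]
  have yl : theta Y {a} = theta Y₀ {a} := by
    rw [hYe, theta_insert_left hY0, theta_singleton_self, zero_add]
  have eB : ∀ B, theta B (insert a E) = theta B {a} + theta B E := fun B =>
    theta_insert_right ha B
  have el : theta (insert a E) {a} = E.card := by
    rw [theta_insert_left ha, theta_singleton_self, zero_add, theta_singleton_right_of_lt hE]
  have aE : theta {a} E = 0 := theta_singleton_left_of_lt hE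
  have aa := theta_singleton_self a
  have hsum := theta_add_left hv.1 {a}
  have hsw := theta_singleton_swap hY0
  have hc : Y₀.card = E.card := by
    have := hv.2
    rw [hYe, Finset.card_insert_of_notMem hY0, Finset.card_insert_of_notMem ha] at this
    omega
  have hXc := hv.card
  have hm : (insert a E).card * F.card = E.card * F.card + F.card := by
    rw [Finset.card_insert_of_notMem ha, Nat.succ_mul]
  have sgn : (X.card + theta {a} Y₀ + (E.card * F.card + theta F E + theta X Y₀)) % 2 =
      ((insert a E).card * F.card + theta F (insert a E) + theta X Y) % 2 := by
    rw [hm, eB, yB]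
    omega
  have hX := theta_sdiff_add_inter X {a} E
  have ex : theta X {a} + (theta (E ∩ X) E + theta (X \ E) Y₀) =
      theta (insert a E ∩ X) (insert a E) + theta (X \ insert a E) Y +
        (if a ∈ X then theta {a} Y else 0) := by
    have y2 := yB (X \ insert a E)
    split_ifs with haX
    -- Here a moves from X \ E, where it is weighed against Y, to the intersection, where it is
    -- weighed against a set with no smaller element. This is the surplus θ_{a,Y}.
    · have h1 : insert a E ∩ X = insert a (E ∩ X) := Finset.insert_inter_of_mem haX
      have h2 : X \ E = insert a (X \ insert a E) := by grind
      have h3 : a ∉ E ∩ X := by grind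
      have h4 : a ∉ X \ insert a E := by grind
      have e1 := eB (insert a (E ∩ X))
      have l1 := theta_insert_left h3 {a}
      have l2 := theta_insert_left h3 E
      have l3 := theta_insert_left h4 Y₀
      have l4 := theta_insert_left h4 {a}
      have y3 := yB {a}
      rw [h1]
      rw [h2] at hX ⊢
      omega
    · have h1 : insert a E ∩ X = E ∩ X := Finset.insert_inter_of_notMem haX
      have h2 : X \ insert a E = X \ E := by grind
      rw [h2] at y2 ⊢
      rw [h1, eB]
      omega
  have ex' : p ^ theta X {a} * p ^ (theta (E ∩ X) E + theta (X \ E) Y₀) =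
      p ^ (theta (insert a E ∩ X) (insert a E) + theta (X \ insert a E) Y) *
        p ^ (if a ∈ X then theta {a} Y else 0) := by
    rw [← pow_add, ex, pow_add p (_ + _)]
  rw [← neg_one_pow_congr_mod (K := K) sgn, pow_add (-1 : K) (X.card + _),
    ← mul_assoc _ (p ^ (if a ∈ X then theta {a} Y else 0)), mul_assoc _ (p ^ _) (p ^ _), ← ex']
  ring

/-- The exchange term for h, normalised as the pass-through term is. What remains is the summand (p
- 1) p^{θ_{h,Y}} of the telescoping sum, with a sign recording whether a ∈ F. -/
theorem braidCoeff_swap (p : K) {a h : I} {E F X Y : Finset I} (hE : ∀ x ∈ E, a < x)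
    (hv : IsExchange (insert a E) F X Y) (hX : a ∈ X) (hY : h ∈ Y) (hhX : h ∉ X) (hha : h < a) :
    (p - 1) * (-p) ^ theta (X.erase a) {h} *
        (-1) ^ (theta {a} (X.erase a) + theta {h} (Y.erase h)) *
        braidCoeff p E F (insert h (X.erase a)) (Y.erase h) =
      (-1) ^ ((insert a E).card * F.card + theta F (insert a E) + theta X Y) *
        p ^ (theta (insert a E ∩ X) (insert a E) + theta (X \ insert a E) Y) *
        ((-1) ^ (if a ∈ F then 1 else 0) * ((p - 1) * p ^ theta {h} Y) *
          ∏ g ∈ (insert a E \ Y).erase a,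
            (p ^ ((theta {g} Y : ℤ) - (theta {g} (insert a E) : ℤ)) - 1)) := by
  have ha : a ∉ E := fun h => lt_irrefl _ (hE a h)
  rw [braidCoeff, if_pos ((isExchange_swap ha hX hY hhX).2 hv),
    braidWeight_erase p hE hY hha.le]
  have hY0 : h ∉ Y.erase h := Finset.notMem_erase h Y
  have hYe : Y = insert h (Y.erase h) := (Finset.insert_erase hY).symm
  set Y₀ := Y.erase h with hY₀
  have hX0 : a ∉ X.erase a := Finset.notMem_erase a X
  have hXe : X = insert a (X.erase a) := (Finset.insert_erase hX).symm
  have hhX0 : h ∉ X.erase a := fun e => hhX (Finset.mem_of_mem_erase e)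
  have hhE : h ∉ E := fun h' => lt_asymm hha (hE h h')
  have i1 : E ∩ insert h (X.erase a) = E ∩ X := by grind
  have i2 : insert h (X.erase a) \ E = insert h (X \ insert a E) := by grind
  have i3 : insert a E ∩ X = insert a (E ∩ X) := Finset.insert_inter_of_mem hX
  have i4 : E ∩ X.erase a = E ∩ X := by grind
  have i5 : X.erase a \ E = X \ insert a E := by grind
  have n1 : h ∉ X \ insert a E := by grind
  have n2 : a ∉ E ∩ X := by grind
  set X₀ := X.erase a with hX₀
  have yB : ∀ B, theta B Y = theta B {h} + theta B Y₀ := fun B => by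
    rw [hYe, theta_insert_right hY0]
  have eB : ∀ B, theta B (insert a E) = theta B {a} + theta B E := fun B =>
    theta_insert_right ha B
  have aE : theta {a} E = 0 := theta_singleton_left_of_lt hE
  have aa := theta_singleton_self a
  have hh := theta_singleton_self h
  have hm : (insert a E).card * F.card = E.card * F.card + F.card := by
    rw [Finset.card_insert_of_notMem ha, Nat.succ_mul]
  have hsum := theta_add_right hv.1 {a}
  have hsw := theta_singleton_swap_add_ite a F
  have xB : ∀ B, theta X B = theta {a} B + theta X₀ B := fun B => by
    rw [hXe, theta_insert_left hX0]
  have ax : theta {a} X = theta {a} {a} + theta {a} X₀ := by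
    rw [hXe, theta_insert_right hX0]
  have sgn : (theta X₀ {h} + (theta {a} X₀ + theta {h} Y₀) +
        (E.card * F.card + theta F E + theta (insert h X₀) Y₀)) % 2 =
      ((insert a E).card * F.card + theta F (insert a E) + theta X Y +
        (if a ∈ F then 1 else 0)) % 2 := by
    rw [hm, eB, xB, theta_insert_left hhX0, yB X₀]
    rw [eB] at hsum
    omega
  have ex : theta X₀ {h} + (theta (E ∩ insert h X₀) E + theta (insert h X₀ \ E) Y₀) =
      theta (insert a E ∩ X) (insert a E) + theta (X \ insert a E) Y + theta {h} Y := by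
    -- Elements of E ∩ X exceed both h and a, so counting those above h and those above a gives the
    -- same number; the remaining elements of X₀ account for the pairing of X \ (E ∪ {a}) with h.
    have e1 := theta_sdiff_add_inter X₀ {h} E
    rw [i4, i5] at e1
    have e2 : theta (E ∩ X) {h} = (E ∩ X).card := theta_singleton_right_of_lt fun x hx =>
      hha.trans (hE x (Finset.mem_inter.1 hx).1)
    have e3 : theta (E ∩ X) {a} = (E ∩ X).card := theta_singleton_right_of_lt fun x hx =>
      hE x (Finset.mem_inter.1 hx).1
    rw [i1, i2, i3, theta_insert_left n1, theta_insert_left n2, eB, eB, yB, yB {h}]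
    omega
  have : (-p) ^ theta X₀ {h} = (-1) ^ theta X₀ {h} * p ^ theta X₀ {h} := by
    rw [← mul_pow, neg_one_mul]
  rw [this]
  trans (p - 1) * (-1) ^ (theta X₀ {h} + (theta {a} X₀ + theta {h} Y₀) +
        (E.card * F.card + theta F E + theta (insert h X₀) Y₀)) *
      p ^ (theta X₀ {h} + (theta (E ∩ insert h X₀) E + theta (insert h X₀ \ E) Y₀)) *
      ∏ g ∈ (insert a E \ Y).erase a,
            (p ^ ((theta {g} Y : ℤ) - (theta {g} (insert a E) : ℤ)) - 1)
  · rw [pow_add (-1 : K) (theta X₀ {h} + _), pow_add (-1 : K) (theta X₀ {h}),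
      pow_add p (theta X₀ {h})]
    ring
  · rw [neg_one_pow_congr_mod (K := K) sgn, ex, pow_add (-1 : K) (_ + _ + _), pow_add p (_ + _)]
    ring

/-- The recursion of the closed form of the coefficients under adjoining a smallest element. -/
theorem braidCoeff_insert (p : K) {a : I} {E : Finset I} (hE : ∀ x ∈ E, a < x)
    (F X Y : Finset I) :
    braidCoeff p (insert a E) F X Y =
      (if a ∈ Y then (-1) ^ (X.card + theta {a} (Y.erase a)) * p ^ theta X {a} *
        braidCoeff p E F X (Y.erase a) else 0) +
      if a ∈ X then ∑ h ∈ (Y \ X).filter (· < a), (p - 1) * (-p) ^ theta (X.erase a) {h} *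
        (-1) ^ (theta {a} (X.erase a) + theta {h} (Y.erase h)) *
        braidCoeff p E F (insert h (X.erase a)) (Y.erase h) else 0 := by
  have ha : a ∉ E := fun h => lt_irrefl _ (hE a h)
  by_cases hv : IsExchange (insert a E) F X Y
  swap
  · rw [braidCoeff, if_neg hv]
    have h1 : ∀ haY : a ∈ Y, braidCoeff p E F X (Y.erase a) = 0 := fun haY => by
      rw [braidCoeff, if_neg fun h => hv ((isExchange_erase ha haY).1 h)]
    have h2 : ∀ haX : a ∈ X, ∀ h ∈ (Y \ X).filter (· < a),
        braidCoeff p E F (insert h (X.erase a)) (Y.erase h) = 0 := fun haX h hh => by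
      rw [Finset.mem_filter, Finset.mem_sdiff] at hh
      rw [braidCoeff, if_neg fun h => hv ((isExchange_swap ha haX hh.1.1 hh.1.2).1 h)]
    split_ifs with haY haX haX
    · rw [h1 haY, Finset.sum_eq_zero fun h hh => by rw [h2 haX h hh, mul_zero]]; simp
    · rw [h1 haY]; simp
    · rw [Finset.sum_eq_zero fun h hh => by rw [h2 haX h hh, mul_zero]]; simp
    · simp
  -- Since a is minimal, θ_{a,E ∪ {a}} = 0, and the factor belonging to a is p^{θ_{a,Y}} - 1.
  have hw : braidWeight p (insert a E) Y = (if a ∈ Y then 1 else p ^ theta {a} Y - 1) *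
      ∏ g ∈ (insert a E \ Y).erase a,
        (p ^ ((theta {g} Y : ℤ) - (theta {g} (insert a E) : ℤ)) - 1) := by
    rw [braidWeight]
    split_ifs with haY
    · rw [Finset.erase_eq_of_notMem (by simp [haY]), one_mul]
    · rw [← Finset.mul_prod_erase (insert a E \ Y) _ (a := a) (by simp [haY]),
        theta_insert_right ha {a}, theta_singleton_self, theta_singleton_left_of_lt hE]
      simp
  -- An element of Y below a is not in E ∪ {a}, so by conservation of multiplicities it comes from F
  -- and cannot also lie in X.
  have hfil : (Y \ X).filter (· < a) = Y.filter (· < a) := by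
    ext h
    simp only [Finset.mem_filter, Finset.mem_sdiff]
    refine ⟨fun h => ⟨h.1.1, h.2⟩, fun hh => ⟨⟨hh.1, (hv.mem_left ?_ hh.1).1⟩, hh.2⟩⟩
    rw [Finset.mem_insert, not_or]
    exact ⟨hh.2.ne, fun h' => lt_asymm hh.2 (hE _ h')⟩
  have tel : ∑ h ∈ (Y \ X).filter (· < a), (p - 1) * p ^ theta {h} Y =
      p ^ theta {a} Y - 1 := by
    rw [hfil, theta_singleton_left, ← sum_sub_one_mul_pow_theta]
    refine Finset.sum_congr rfl fun h hh => ?_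
    rw [theta_singleton_left, theta_singleton_left, Finset.filter_filter]
    congr 3
    refine Finset.filter_congr fun x _ => ?_
    exact ⟨fun h' => ⟨h'.trans (Finset.mem_filter.1 hh).2, h'⟩, fun h => h.2⟩
  have hs : a ∈ X → ∑ h ∈ (Y \ X).filter (· < a), (p - 1) * (-p) ^ theta (X.erase a) {h} *
        (-1) ^ (theta {a} (X.erase a) + theta {h} (Y.erase h)) *
        braidCoeff p E F (insert h (X.erase a)) (Y.erase h) =
      (-1) ^ ((insert a E).card * F.card + theta F (insert a E) + theta X Y) *
        p ^ (theta (insert a E ∩ X) (insert a E) + theta (X \ insert a E) Y) *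
        ((-1) ^ (if a ∈ F then 1 else 0) * (p ^ theta {a} Y - 1) *
          ∏ g ∈ (insert a E \ Y).erase a,
            (p ^ ((theta {g} Y : ℤ) - (theta {g} (insert a E) : ℤ)) - 1)) := fun haX => by
    rw [← tel, Finset.mul_sum, Finset.sum_mul, Finset.mul_sum]
    refine Finset.sum_congr rfl fun h hh => ?_
    rw [Finset.mem_filter, Finset.mem_sdiff] at hh
    exact braidCoeff_swap p hE hv haX hh.1.1 hh.1.2 hh.2
  have hcount := hv.count a
  simp only [Finset.mem_insert_self, if_true] at hcount
  rw [braidCoeff, if_pos hv, hw]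
  -- With t = p^{θ_{a,Y}}, the factor of a comes out as t - (t - 1) = 1 if a is in both sets, as 1
  -- if only in Y, and as t - 1 if only in X. It cannot be in neither.
  by_cases haY : a ∈ Y <;> by_cases haX : a ∈ X
  · have haF : a ∈ F := by by_contra h; simp [haY, haX, h] at hcount
    rw [if_pos haY, if_pos haY, if_pos haX, hs haX, braidCoeff_erase p hE hv haY, if_pos haX,
      if_pos haF]
    ring
  · rw [if_pos haY, if_pos haY, if_neg haX, braidCoeff_erase p hE hv haY, if_neg haX]
    ring
  · have haF : a ∉ F := by intro h; simp [haY, haX, h] at hcount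
    rw [if_neg haY, if_neg haY, if_pos haX, hs haX, if_neg haF]
    ring
  · simp [haY, haX] at hcount
    omega

end Recursion

/-! ### The matrix of the braiding in the set-theoretic basis -/

section Crossing

variable {K V I : Type*} [Field K] [AddCommGroup V] [Module K V] [LinearOrder I]

theorem setVec_empty (b : Module.Basis I K V) : setVec b ∅ = 1 := by
  simp [setVec_eq_prod]

theorem setVec_insert_of_lt (b : Module.Basis I K V) {a : I} {S : Finset I}
    (h : ∀ x ∈ S, a < x) :
    setVec b (insert a S) = ExteriorAlgebra.ι K (b a) * setVec b S := by
  rw [setVec_eq_prod, setVec_eq_prod,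
    Finset.sort_insert (r := (· ≤ ·)) (fun x hx => (h x hx).le) fun h' => lt_irrefl _ (h a h')]
  simp

theorem ι_mul_swap (x y : V) (z : ExteriorAlgebra K V) :
    ExteriorAlgebra.ι K x * (ExteriorAlgebra.ι K y * z) =
      -(ExteriorAlgebra.ι K y * (ExteriorAlgebra.ι K x * z)) := by
  rw [← mul_assoc, ← mul_assoc, eq_neg_of_add_eq_zero_left (ExteriorAlgebra.ι_add_mul_swap x y),
    neg_mul]

/-- Sorting i into place moves it past the θ_{i,S} smaller elements of S, with one sign for each; a
repeated factor gives zero. -/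
theorem ι_mul_setVec (b : Module.Basis I K V) (i : I) (S : Finset I) :
    ExteriorAlgebra.ι K (b i) * setVec b S =
      if i ∈ S then 0 else (-1 : K) ^ theta {i} S • setVec b (insert i S) := by
  induction S using Finset.induction_on_min with
  | empty =>
    rw [if_neg (Finset.notMem_empty i), theta_empty_right, pow_zero, one_smul,
      setVec_insert_of_lt b (by simp)]
  | insert k S hS ih =>
    have hk : k ∉ S := fun h => lt_irrefl _ (hS k h)
    rcases lt_trichotomy i k with h | h | h
    · have hlt : ∀ x ∈ insert k S, i < x := by
        intro x hx
        rcases Finset.mem_insert.1 hx with rfl | hx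
        · exact h
        · exact h.trans (hS x hx)
      rw [if_neg fun h => lt_irrefl _ (hlt i h), setVec_insert_of_lt b hlt,
        theta_singleton_left_of_lt hlt, pow_zero, one_smul]
    · subst h
      rw [if_pos (Finset.mem_insert_self _ _), setVec_insert_of_lt b hS, ← mul_assoc,
        ExteriorAlgebra.ι_sq_zero, zero_mul]
    · rw [setVec_insert_of_lt b hS, ι_mul_swap, ih]
      by_cases hi : i ∈ S
      · simp [hi]
      · have hlt : ∀ x ∈ insert i S, k < x := by
          intro x hx
          rcases Finset.mem_insert.1 hx with rfl | hx
          · exact h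
          · exact hS x hx
        rw [if_neg hi, if_neg (by simp [hi, h.ne']), Finset.insert_comm,
          setVec_insert_of_lt b hlt, theta_insert_right hk, theta_singleton_singleton h,
          pow_add, mul_smul_comm]
        simp

/-- One basis vector crossing a strand labelled by `f_F`. -/
theorem extCrossV_setVec (b : Module.Basis I K V) (p : K) (i : I) (F : Finset I) :
    extCrossV b p (b i ⊗ₜ setVec b F) =
      ((-1) ^ F.card * p ^ theta F {i}) • (setVec b F ⊗ₜ[K] b i) +
        ∑ h ∈ F.filter (· < i), ((p - 1) * (-p) ^ theta F {h}) •
          ((ExteriorAlgebra.ι K (b i) * setVec b (F.erase h)) ⊗ₜ[K] b h) := by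
  induction F using Finset.induction_on_min generalizing i with
  | empty => simp [setVec_empty, extCrossV_one, theta_empty_left]
  | insert k F hF ih =>
    have hk : k ∉ F := fun h => lt_irrefl _ (hF k h)
    have hth : ∀ j, theta (insert k F) {j} = (if j < k then 1 else 0) + theta F {j} := by
      intro j
      rw [theta_insert_left hk]
      simp only [theta, heaviside, Finset.sum_singleton]
    have hfk : F.filter (· < k) = ∅ :=
      Finset.filter_eq_empty_iff.2 fun x hx => (hF x hx).not_gt
    -- Passing the smaller element k costs a factor -1, compensated by the sign from moving b i back
    -- to the front. So only elements above h contribute to the power of -p.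
    have hsum : ∑ h ∈ F.filter (· < i), ((p - 1) * (-p) ^ theta (insert k F) {h}) •
          ((ExteriorAlgebra.ι K (b i) * setVec b ((insert k F).erase h)) ⊗ₜ[K] b h) =
        -LinearMap.rTensor V (LinearMap.mulLeft K (ExteriorAlgebra.ι K (b k)))
          (∑ h ∈ F.filter (· < i), ((p - 1) * (-p) ^ theta F {h}) •
            ((ExteriorAlgebra.ι K (b i) * setVec b (F.erase h)) ⊗ₜ[K] b h)) := by
      rw [map_sum, ← Finset.sum_neg_distrib]
      refine Finset.sum_congr rfl fun h hh => ?_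
      have hhF := (Finset.mem_filter.1 hh).1
      have hkh := hF h hhF
      rw [map_smul, LinearMap.rTensor_tmul, LinearMap.mulLeft_apply, ι_mul_swap,
        TensorProduct.neg_tmul, smul_neg, neg_neg, hth, if_neg hkh.not_gt, zero_add,
        Finset.erase_insert_of_ne hkh.ne,
        setVec_insert_of_lt b fun x hx => hF x (Finset.mem_of_mem_erase hx)]
    rw [setVec_insert_of_lt b hF, extCrossV_ι_mul, ih k, ih i, hfk, Finset.sum_empty, add_zero,
      Finset.filter_insert, map_add, smul_add, map_smul, map_smul, LinearMap.rTensor_tmul,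
      LinearMap.rTensor_tmul, LinearMap.mulLeft_apply, LinearMap.mulLeft_apply,
      theta_singleton_right_of_lt hF, hth i, Finset.card_insert_of_notMem hk]
    -- Only for k < i does τ exchange i with k. The vector b k then crosses F, all of whose elements
    -- are larger, without further exchange: this is the new summand h = k.
    rcases lt_trichotomy i k with h | h | h
    · have hfi : F.filter (· < i) = ∅ :=
        Finset.filter_eq_empty_iff.2 fun x hx => (h.trans (hF x hx)).not_gt
      simp only [heaviside, h, h.not_gt, if_true, if_false, hfi, Finset.sum_empty, pow_zero,
        sub_self, map_zero, add_zero, smul_zero, smul_smul]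
      module
    · subst h
      simp only [heaviside, lt_irrefl, if_false, hfk, Finset.sum_empty, pow_zero,
        sub_self, map_zero, add_zero, smul_zero, smul_smul, theta_singleton_right_of_lt hF]
      module
    · have hki : k ∉ F.filter (· < i) := fun h => hk (Finset.mem_filter.1 h).1
      rw [if_pos h, Finset.sum_insert hki, hsum, hth k, theta_singleton_right_of_lt hF,
        Finset.erase_insert hk]
      simp only [heaviside, h, h.not_gt, lt_irrefl, if_true, if_false, pow_zero, pow_one, zero_add,
        one_smul, smul_smul, neg_pow p]
      module

/-- One basis vector crossing a strand of the left factor of `f_{P,Q}`. -/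
theorem stepLeft_setVec (b : Module.Basis I K V) (p : K) (a : I) (P Q : Finset I) :
    stepLeft (extCrossV b p) (ExteriorAlgebra.ι K) (b a) (setVec b P ⊗ₜ setVec b Q) =
      ((-1) ^ P.card * p ^ theta P {a}) •
          (setVec b P ⊗ₜ[K] (ExteriorAlgebra.ι K (b a) * setVec b Q)) +
        ∑ h ∈ P.filter (· < a), ((p - 1) * (-p) ^ theta P {h}) •
          ((ExteriorAlgebra.ι K (b a) * setVec b (P.erase h)) ⊗ₜ[K]
            (ExteriorAlgebra.ι K (b h) * setVec b Q)) := by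
  rw [stepLeft_apply, extCrossV_setVec]
  simp

theorem setBasis_repr_tmul (b : Module.Basis I K V) (P Q X Y : Finset I) :
    (setBasis b).repr (setVec b P ⊗ₜ setVec b Q) (X, Y) = if P = X ∧ Q = Y then 1 else 0 := by
  rw [← setBasis_apply, Module.Basis.repr_self, Finsupp.single_apply]
  simp only [Prod.mk.injEq]

theorem setBasis_induction (b : Module.Basis I K V)
    {P : ExteriorAlgebra K V ⊗[K] ExteriorAlgebra K V → Prop}
    (add : ∀ x y, P x → P y → P (x + y)) (smul : ∀ (c : K) x, P x → P (c • x))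
    (vec : ∀ E F : Finset I, P (setVec b E ⊗ₜ setVec b F))
    (z : ExteriorAlgebra K V ⊗[K] ExteriorAlgebra K V) : P z := by
  have hz := (setBasis b).mem_span z
  induction hz using Submodule.span_induction with
  | mem x hx =>
    obtain ⟨⟨E, F⟩, rfl⟩ := hx
    rw [setBasis_apply]
    exact vec E F
  | zero => simpa using smul 0 _ (vec ∅ ∅)
  | add x y _ _ hx hy => exact add x y hx hy
  | smul c x _ hx => exact smul c x hx

/-- The matrix of `stepLeft` in the basis `f_{X,Y}`. -/
theorem repr_stepLeft (b : Module.Basis I K V) (p : K) (a : I) (X Y : Finset I)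
    (z : ExteriorAlgebra K V ⊗[K] ExteriorAlgebra K V) :
    (setBasis b).repr (stepLeft (extCrossV b p) (ExteriorAlgebra.ι K) (b a) z) (X, Y) =
      (if a ∈ Y then (-1) ^ (X.card + theta {a} (Y.erase a)) * p ^ theta X {a} *
        (setBasis b).repr z (X, Y.erase a) else 0) +
      if a ∈ X then ∑ h ∈ (Y \ X).filter (· < a), (p - 1) * (-p) ^ theta (X.erase a) {h} *
        (-1) ^ (theta {a} (X.erase a) + theta {h} (Y.erase h)) *
        (setBasis b).repr z (insert h (X.erase a), Y.erase h) else 0 := by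
  induction z using setBasis_induction b with
  | add x y hx hy =>
    simp only [map_add, Finsupp.add_apply, hx, hy, mul_add, Finset.sum_add_distrib]
    split_ifs <;> ring
  | smul c x hx =>
    simp only [map_smul, Finsupp.smul_apply, hx, smul_eq_mul, mul_left_comm _ c,
      ← Finset.mul_sum, mul_add]
    split_ifs <;> ring
  | vec P Q =>
    rw [stepLeft_setVec, map_add, Finsupp.add_apply, map_smul, Finsupp.smul_apply, map_sum,
      Finset.sum_apply']
    congr 1
    · rw [ι_mul_setVec, setBasis_repr_tmul]
      by_cases haQ : a ∈ Q
      · rw [if_pos haQ, TensorProduct.tmul_zero, map_zero, Finsupp.zero_apply, smul_zero]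
        split_ifs with haY h
        · exact absurd (h.2 ▸ haQ) (Finset.notMem_erase a Y)
        · rw [mul_zero]
        · rfl
      · rw [if_neg haQ, TensorProduct.tmul_smul, map_smul, Finsupp.smul_apply,
          setBasis_repr_tmul]
        have : (P = X ∧ insert a Q = Y) ↔ a ∈ Y ∧ P = X ∧ Q = Y.erase a := by
          constructor
          · rintro ⟨rfl, rfl⟩
            simp [haQ]
          · rintro ⟨haY, rfl, rfl⟩
            simp [Finset.insert_erase haY]
        by_cases h : P = X ∧ insert a Q = Y
        · obtain ⟨h1, h2, h3⟩ := this.1 h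
          rw [if_pos h, if_pos h1, if_pos ⟨h2, h3⟩, ← h2, ← h3, pow_add, smul_eq_mul, smul_eq_mul]
          ring
        · rw [if_neg h, smul_zero, smul_zero]
          by_cases h1 : a ∈ Y
          · rw [if_pos h1, if_neg fun h2 => h (this.2 ⟨h1, h2⟩), mul_zero]
          · rw [if_neg h1]
    · have hl : ∀ h, h < a → (setBasis b).repr (((p - 1) * (-p) ^ theta P {h}) •
          ((ExteriorAlgebra.ι K (b a) * setVec b (P.erase h)) ⊗ₜ[K]
            (ExteriorAlgebra.ι K (b h) * setVec b Q))) (X, Y) =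
          if a ∉ P ∧ h ∉ Q ∧ insert a (P.erase h) = X ∧ insert h Q = Y then
            (p - 1) * (-p) ^ theta P {h} * (-1) ^ (theta {a} (P.erase h) + theta {h} Q)
          else 0 := by
        intro h hha
        have hm : a ∈ P.erase h ↔ a ∈ P := by simp [hha.ne']
        rw [ι_mul_setVec, ι_mul_setVec, map_smul, Finsupp.smul_apply]
        by_cases h1 : a ∈ P
        · simp [h1, hha.ne']
        by_cases h2 : h ∈ Q
        · simp [h2]
        rw [if_neg (hm.not.2 h1), if_neg h2, TensorProduct.tmul_smul, ← TensorProduct.smul_tmul',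
          map_smul, map_smul, Finsupp.smul_apply, Finsupp.smul_apply, setBasis_repr_tmul]
        simp only [h1, h2, not_false_eq_true, true_and, smul_eq_mul]
        split_ifs
        · ring
        · ring
      -- The exchange (P, Q) ↦ (X, Y) is inverted: for given h and a, each pair determines the
      -- other.
      have hiff : ∀ h, h < a → ((h ∈ P ∧ a ∉ P ∧ h ∉ Q ∧ insert a (P.erase h) = X ∧
          insert h Q = Y) ↔ (a ∈ X ∧ h ∈ Y ∧ h ∉ X ∧ P = insert h (X.erase a) ∧
            Q = Y.erase h)) := by
        intro h hha
        constructor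
        · rintro ⟨hP, haP, hQ, rfl, rfl⟩
          have : a ∉ P.erase h := fun e => haP (Finset.mem_of_mem_erase e)
          simp [hha.ne, hQ, Finset.erase_insert this, Finset.insert_erase hP]
        · rintro ⟨haX, hhY, hhX, rfl, rfl⟩
          have : h ∉ X.erase a := fun e => hhX (Finset.mem_of_mem_erase e)
          simp [hha.ne', Finset.erase_insert this, Finset.insert_erase haX,
            Finset.insert_erase hhY]
      -- One sum runs over part of P, the other over part of Y. Both are extended by zero to a
      -- common index set and compared term by term.
      trans ∑ h ∈ (P ∪ Y).filter (· < a), if h ∈ P ∧ a ∉ P ∧ h ∉ Q ∧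
          insert a (P.erase h) = X ∧ insert h Q = Y then
            (p - 1) * (-p) ^ theta P {h} * (-1) ^ (theta {a} (P.erase h) + theta {h} Q)
          else 0
      · refine Finset.sum_subset_zero_on_sdiff
          (Finset.filter_subset_filter _ Finset.subset_union_left) ?_ ?_
        · intro h hh
          rw [if_neg]
          rintro ⟨hP, -⟩
          simp only [Finset.mem_sdiff, Finset.mem_filter] at hh
          exact hh.2 ⟨hP, hh.1.2⟩
        · intro h hh
          rw [Finset.mem_filter] at hh
          rw [hl h hh.2]
          simp only [hh.1, true_and]
      · have hr : ∀ h, h < a → (if h ∈ P ∧ a ∉ P ∧ h ∉ Q ∧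
            insert a (P.erase h) = X ∧ insert h Q = Y then
              (p - 1) * (-p) ^ theta P {h} * (-1) ^ (theta {a} (P.erase h) + theta {h} Q)
            else 0) = if a ∈ X ∧ h ∈ Y ∧ h ∉ X then
              (p - 1) * (-p) ^ theta (X.erase a) {h} *
                (-1) ^ (theta {a} (X.erase a) + theta {h} (Y.erase h)) *
                (setBasis b).repr (setVec b P ⊗ₜ setVec b Q) (insert h (X.erase a), Y.erase h)
            else 0 := by
          intro h hha
          rw [setBasis_repr_tmul]
          simp only [hiff h hha]
          by_cases hc : a ∈ X ∧ h ∈ Y ∧ h ∉ X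
          · rw [if_pos hc]
            by_cases he : P = insert h (X.erase a) ∧ Q = Y.erase h
            · have hn : h ∉ X.erase a := fun e => hc.2.2 (Finset.mem_of_mem_erase e)
              rw [if_pos ⟨hc.1, hc.2.1, hc.2.2, he⟩, if_pos he, he.1, he.2,
                theta_insert_left hn, theta_singleton_self, Finset.erase_insert hn]
              simp
            · rw [if_neg fun h => he h.2.2.2, if_neg he, mul_zero]
          · rw [if_neg hc, if_neg fun h => hc ⟨h.1, h.2.1, h.2.2.1⟩]
        rw [Finset.sum_congr rfl fun h hh => hr h (Finset.mem_filter.1 hh).2]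
        by_cases haX : a ∈ X
        · rw [if_pos haX]
          symm
          refine Finset.sum_subset_zero_on_sdiff (Finset.filter_subset_filter _
            (Finset.sdiff_subset.trans Finset.subset_union_right)) ?_ ?_
          · intro h hh
            rw [if_neg]
            rintro ⟨-, hY, hX⟩
            simp only [Finset.mem_sdiff, Finset.mem_filter] at hh
            exact hh.2 ⟨⟨hY, hX⟩, hh.1.2⟩
          · intro h hh
            rw [Finset.mem_filter, Finset.mem_sdiff] at hh
            rw [if_pos ⟨haX, hh.1⟩]
        · rw [if_neg haX]
          exact Finset.sum_eq_zero fun h _ => if_neg fun h => haX h.1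

/-- The matrix of the braiding in the basis `f_{X,Y}`. -/
theorem repr_extBraiding (b : Module.Basis I K V) (p : K) (E F X Y : Finset I) :
    (setBasis b).repr (extBraiding b p (setVec b E ⊗ₜ setVec b F)) (X, Y) =
      braidCoeff p E F X Y := by
  rw [extBraiding, crossA_apply]
  induction E using Finset.induction_on_min generalizing X Y with
  | empty =>
    rw [setVec_empty, map_one, Module.End.one_apply, ← setVec_empty b, setBasis_repr_tmul,
      braidCoeff]
    have : (F = X ∧ ∅ = Y) ↔ IsExchange ∅ F X Y := by
      unfold IsExchange
      rw [Finset.card_empty, Finset.card_eq_zero]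
      constructor
      · rintro ⟨rfl, rfl⟩
        simp
      · rintro ⟨h, rfl⟩
        simpa [eq_comm] using h
    by_cases h : F = X ∧ ∅ = Y
    · rw [if_pos h, if_pos (this.1 h), ← h.2]
      simp [theta_empty_right, braidWeight]
    · rw [if_neg h, if_neg fun h' => h (this.2 h')]
  | insert a E hE ih =>
    rw [setVec_insert_of_lt b hE, map_mul, Module.End.mul_apply, extLeft_ι, repr_stepLeft,
      braidCoeff_insert p hE]
    simp only [ih]

end Crossing

/-! ### Pairs (X, Y) as exchanges of G and H; non-vanishing of α -/

section Exchange

variable {I : Type*} [LinearOrder I]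

theorem val_add_val_eq_iff {A B C D : Finset I} : A.val + B.val = C.val + D.val ↔
    ∀ x, (if x ∈ A then 1 else 0) + (if x ∈ B then 1 else 0) =
      (if x ∈ C then 1 else 0) + (if x ∈ D then 1 else 0) := by
  rw [Multiset.ext]
  refine forall_congr' fun x => ?_
  simp [Multiset.count_add, Multiset.count_eq_of_nodup, Finset.nodup]

theorem exchange_val_add {E G H : Finset I} (hG : G ⊆ E) (hH : Disjoint E H) :
    (exchange E G H).val + G.val = E.val + H.val := by
  rw [val_add_val_eq_iff]
  intro x
  have h1 := @hG x
  have h2 : x ∈ E → x ∉ H := fun h => Finset.disjoint_left.1 hH h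
  simp only [exchange, Finset.mem_union, Finset.mem_sdiff]
  by_cases x ∈ E <;> by_cases x ∈ G <;> by_cases x ∈ H <;> simp_all

theorem card_exchange {E G H : Finset I} (hG : G ⊆ E) (hH : Disjoint E H)
    (h : G.card = H.card) : (exchange E G H).card = E.card := by
  have := congrArg Multiset.card (exchange_val_add hG hH)
  simp only [Multiset.card_add, Finset.card_val] at this
  omega

theorem sdiff_exchange {E F G H : Finset I} (hG : G ⊆ E \ F) (hH : H ⊆ F \ E) :
    E \ exchange E G H = G := by
  ext x
  have h1 := @hG x
  have h2 := @hH x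
  simp only [exchange, Finset.mem_union, Finset.mem_sdiff] at *
  tauto

theorem exchange_sdiff {E F G H : Finset I} (hH : H ⊆ F \ E) :
    exchange E G H \ E = H := by
  ext x
  have h2 := @hH x
  simp only [exchange, Finset.mem_union, Finset.mem_sdiff] at *
  tauto

theorem isExchange_exchange {E F G H : Finset I} (hG : G ⊆ E \ F) (hH : H ⊆ F \ E)
    (h : G.card = H.card) : IsExchange E F (exchange F H G) (exchange E G H) := by
  have dG : Disjoint F G := Finset.disjoint_of_subset_right hG Finset.disjoint_sdiff
  have dH : Disjoint E H := Finset.disjoint_of_subset_right hH Finset.disjoint_sdiff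
  have sG := hG.trans Finset.sdiff_subset
  have sH := hH.trans Finset.sdiff_subset
  refine ⟨?_, card_exchange sG dH h⟩
  have e1 := exchange_val_add sG dH
  have e2 := exchange_val_add sH dG
  have : (exchange F H G).val + (exchange E G H).val + (G.val + H.val) =
      E.val + F.val + (G.val + H.val) := by
    calc _ = ((exchange F H G).val + H.val) + ((exchange E G H).val + G.val) := by abel
      _ = _ := by rw [e1, e2]; abel
  exact add_right_cancel this

/-- Multiplicities force every element of E ∩ F to stay in both X and Y, so all change is recorded
by what E loses and what it gains. Hence each pair in the support comes from an exchange. -/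
theorem IsExchange.eq_exchange {E F X Y : Finset I} (h : IsExchange E F X Y) :
    E \ Y ⊆ E \ F ∧ Y \ E ⊆ F \ E ∧ (Y \ E).card = (E \ Y).card ∧
      exchange F (Y \ E) (E \ Y) = X ∧ exchange E (E \ Y) (Y \ E) = Y := by
  refine ⟨fun x => ?_, fun x => ?_, ?_, ?_, ?_⟩
  · have := h.count x
    simp only [Finset.mem_sdiff]
    by_cases x ∈ E <;> by_cases x ∈ F <;> by_cases x ∈ X <;> by_cases x ∈ Y <;> simp_all
  · have := h.count x
    simp only [Finset.mem_sdiff]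
    by_cases x ∈ E <;> by_cases x ∈ F <;> by_cases x ∈ X <;> by_cases x ∈ Y <;> simp_all
  · have h1 := Finset.card_sdiff_add_card_inter Y E
    have h2 := Finset.card_sdiff_add_card_inter E Y
    rw [Finset.inter_comm] at h2
    have := h.2
    omega
  · ext x
    have := h.count x
    simp only [exchange, Finset.mem_union, Finset.mem_sdiff]
    by_cases x ∈ E <;> by_cases x ∈ F <;> by_cases x ∈ X <;> by_cases x ∈ Y <;> simp_all
  · ext x
    simp only [exchange, Finset.mem_union, Finset.mem_sdiff]
    tauto

theorem alpha_eq_prod {K : Type*} [Field K] (p : K) (G H : Finset I) :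
    alpha p G H = ∏ g ∈ G, (p ^ ((theta {g} H : ℤ) - (theta {g} G : ℤ)) - 1) := by
  rw [alpha, Finset.powersetCard_one, Finset.prod_map]
  rfl

/-- Passing from E to E' adds H and removes G, so θ_{g,E'} - θ_{g,E} = θ_{g,H} - θ_{g,G}. -/
theorem braidWeight_exchange {K : Type*} [Field K] (p : K) {E F G H : Finset I}
    (hG : G ⊆ E \ F) (hH : H ⊆ F \ E) : braidWeight p E (exchange E G H) = alpha p G H := by
  rw [braidWeight, sdiff_exchange hG hH, alpha_eq_prod]
  refine Finset.prod_congr rfl fun g _ => ?_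
  have := theta_add_right (exchange_val_add (hG.trans Finset.sdiff_subset)
    (Finset.disjoint_of_subset_right hH Finset.disjoint_sdiff)) {g}
  congr 2
  omega

/-- The genericity criterion for the non-vanishing of `alpha`. -/
theorem alpha_ne_zero_iff {K : Type*} [Field K] {p : K} (hp : ∀ n : ℕ, 0 < n → p ^ n ≠ 1)
    (G H : Finset I) :
    alpha p G H ≠ 0 ↔ ∀ A ∈ G.powersetCard 1, theta A G < theta A H := by
  have hA : (∀ A ∈ G.powersetCard 1, theta A G < theta A H) ↔
      ∀ g ∈ G, theta {g} G < theta {g} H := by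
    simp [Finset.powersetCard_one]
  rw [hA, alpha_eq_prod, Finset.prod_ne_zero_iff]
  constructor
  · intro h g
    by_contra! hcon
    -- Take the least g₀ ∈ G with θ_{g₀,H} ≤ θ_{g₀,G}. Equality would give the zero factor p^0 - 1,
    -- so the inequality is strict and g₀ has a predecessor m in G. By minimality θ_{m,G} < θ_{m,H};
    -- but from m to g₀ the count in G grows by at most 1 and the count in H does not decrease, a
    -- contradiction.
    obtain ⟨g₀, hg₀, hmin⟩ := Finset.exists_min_image
      (G.filter fun g => theta {g} H ≤ theta {g} G) id (by
        obtain ⟨hg, hle⟩ := hcon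
        exact ⟨g, Finset.mem_filter.2 ⟨hg, hle⟩⟩)
    rw [Finset.mem_filter] at hg₀
    have hne : theta {g₀} H ≠ theta {g₀} G := by
      intro e
      apply h g₀ hg₀.1
      rw [e]
      simp
    have hlt : theta {g₀} H < theta {g₀} G := lt_of_le_of_ne hg₀.2 hne
    have hcard : (G.filter (· < g₀)).Nonempty := by
      rw [← Finset.card_pos, ← theta_singleton_left]
      omega
    obtain ⟨m, hm, hmax⟩ := Finset.exists_max_image _ id hcard
    rw [Finset.mem_filter] at hm
    have h1 : theta {m} G < theta {m} H := by
      by_contra! hle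
      exact absurd (hmin m (Finset.mem_filter.2 ⟨hm.1, hle⟩)) (not_le.2 hm.2)
    have h2 : theta {m} H ≤ theta {g₀} H := by
      rw [theta_singleton_left, theta_singleton_left]
      exact Finset.card_le_card (Finset.monotone_filter_right _ fun x _ hx => hx.trans hm.2)
    have h3 : theta {g₀} G ≤ theta {m} G + 1 := by
      rw [theta_singleton_left, theta_singleton_left,
        ← Finset.card_insert_of_notMem (a := m) (by simp)]
      refine Finset.card_le_card fun x hx => ?_
      have hxm : x ≤ m := hmax x hx
      rw [Finset.mem_filter] at hx
      rw [Finset.mem_insert, Finset.mem_filter]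
      exact hxm.eq_or_lt.imp id fun h => ⟨hx.1, h⟩
    omega
  · intro h g hg
    have hlt := h g hg
    rw [← Nat.cast_sub hlt.le, zpow_natCast, sub_ne_zero]
    exact hp _ (by omega)

end Exchange

/-! ### The exchange channels and their sum -/

section Channels

variable {K V I : Type*} [Field K] [AddCommGroup V] [Module K V] [LinearOrder I]

theorem exchangeCoeff_eq_braidCoeff (b : Module.Basis I K V) (p : K) (E G F H : Finset I) :
    exchangeCoeff b p E G F H =
      (-1) ^ (E.card * F.card) * braidCoeff p E F (exchange F H G) (exchange E G H) := by
  rw [exchangeCoeff, repr_extBraiding]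

/-- Specialises the closed form to X = F', Y = E', where E ∩ F' = G ∪ C and F' \ E = Ḟ. The
normalising sign cancels against the one in the closed form. -/
theorem exchangeCoeff_eq_beta (b : Module.Basis I K V) (p : K) {E F G H : Finset I}
    (hG : G ⊆ E \ F) (hH : H ⊆ F \ E) (h : G.card = H.card) :
    exchangeCoeff b p E G F H = beta p E G F H := by
  rw [exchangeCoeff_eq_braidCoeff, braidCoeff, if_pos (isExchange_exchange hG hH h),
    braidWeight_exchange p hG hH, beta]
  have i1 : E ∩ exchange F H G = G ∪ (E ∩ F) := by
    ext x
    have h1 := @hG x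
    have h2 := @hH x
    simp only [exchange, Finset.mem_union, Finset.mem_sdiff, Finset.mem_inter] at *
    tauto
  have i2 : exchange F H G \ E = (F \ E) \ H := by
    ext x
    have h1 := @hG x
    have h2 := @hH x
    simp only [exchange, Finset.mem_union, Finset.mem_sdiff] at *
    tauto
  rw [i1, i2, add_assoc, pow_add (-1 : K) (E.card * F.card), ← mul_assoc, ← mul_assoc, ← mul_assoc,
    ← pow_add, Even.neg_one_pow ⟨_, rfl⟩, one_mul]

theorem channel_setVec (b : Module.Basis I K V) (p : K) (k : ℕ) (E F : Finset I) :
    channel b p k (setVec b E ⊗ₜ setVec b F) =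
      ∑ G ∈ (E \ F).powersetCard k, ∑ H ∈ (F \ E).powersetCard k,
        braidCoeff p E F (exchange F H G) (exchange E G H) •
          (setVec b (exchange F H G) ⊗ₜ[K] setVec b (exchange E G H)) := by
  rw [← setBasis_apply, channel, Module.Basis.constr_basis, Finset.smul_sum]
  refine Finset.sum_congr rfl fun G _ => ?_
  rw [Finset.smul_sum]
  refine Finset.sum_congr rfl fun H _ => ?_
  rw [exchangeCoeff_eq_braidCoeff, smul_smul, ← mul_assoc, ← pow_add, Even.neg_one_pow ⟨_, rfl⟩,
    one_mul]

theorem extBraiding_setVec_eq_sum (b : Module.Basis I K V) (p : K) (E F : Finset I) {N : ℕ}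
    (hN : E.card < N) :
    extBraiding b p (setVec b E ⊗ₜ setVec b F) =
      ∑ k ∈ Finset.range N, channel b p k (setVec b E ⊗ₜ setVec b F) := by
  apply (setBasis b).repr.injective
  ext ⟨X, Y⟩
  rw [repr_extBraiding]
  simp only [channel_setVec, map_sum, Finset.sum_apply', map_smul, Finsupp.smul_apply,
    setBasis_repr_tmul, smul_eq_mul, mul_ite, mul_one, mul_zero]
  by_cases hv : IsExchange E F X Y
  · obtain ⟨h1, h2, h3, h4, h5⟩ := hv.eq_exchange
    -- Exactly one triple (k, G, H) reaches the pair (X, Y), namely G = E \ Y, H = Y \ E and their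
    -- common size.
    rw [Finset.sum_eq_single (E \ Y).card, Finset.sum_eq_single (E \ Y),
      Finset.sum_eq_single (Y \ E), h4, h5, if_pos ⟨rfl, rfl⟩]
    · intro H hH hne
      refine if_neg fun h => hne ?_
      rw [← h.2, exchange_sdiff (Finset.mem_powersetCard.1 hH).1]
    · exact fun h => absurd (Finset.mem_powersetCard.2 ⟨h2, h3⟩) h
    · intro G hG hne
      refine Finset.sum_eq_zero fun H hH => if_neg fun h => hne ?_
      rw [← h.2, sdiff_exchange (Finset.mem_powersetCard.1 hG).1 (Finset.mem_powersetCard.1 hH).1]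
    · exact fun h => absurd (Finset.mem_powersetCard.2 ⟨h1, rfl⟩) h
    · intro k _ hne
      refine Finset.sum_eq_zero fun G hG => Finset.sum_eq_zero fun H hH =>
        if_neg fun h => hne ?_
      rw [Finset.mem_powersetCard] at hG hH
      rw [← h.2, sdiff_exchange hG.1 hH.1, hG.2]
    · intro h
      -- The size of an exchange is at most |E|, so the bound |E| < N leaves out no channel.
      refine absurd (Finset.mem_range.2 (lt_of_le_of_lt ?_ hN)) h
      exact Finset.card_le_card Finset.sdiff_subset
  · rw [braidCoeff, if_neg hv]
    refine (Finset.sum_eq_zero fun k _ => Finset.sum_eq_zero fun G hG =>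
      Finset.sum_eq_zero fun H hH => if_neg fun h => hv ?_).symm
    rw [Finset.mem_powersetCard] at hG hH
    rw [← h.1, ← h.2]
    exact isExchange_exchange hG.1 hH.1 (hG.2.trans hH.2.symm)

/-- The assertion covers every M beyond N, not only N itself, so that the bounds for two summands
can be merged by taking their maximum. -/
theorem exists_extBraiding_eq_sum (b : Module.Basis I K V) (p : K)
    (x : ExteriorAlgebra K V ⊗[K] ExteriorAlgebra K V) :
    ∃ N : ℕ, ∀ M, N ≤ M → channel b p M x = 0 ∧
      extBraiding b p x = ∑ k ∈ Finset.range M, channel b p k x := by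
  induction x using setBasis_induction b with
  | add x y hx hy =>
    obtain ⟨N, hN⟩ := hx
    obtain ⟨N', hN'⟩ := hy
    refine ⟨max N N', fun M hM => ?_⟩
    have h1 := hN M (le_of_max_le_left hM)
    have h2 := hN' M (le_of_max_le_right hM)
    simp only [map_add, h1.1, h2.1, h1.2, h2.2, add_zero, Finset.sum_add_distrib, and_self]
  | smul c x hx =>
    obtain ⟨N, hN⟩ := hx
    refine ⟨N, fun M hM => ?_⟩
    simp only [map_smul, (hN M hM).1, (hN M hM).2, smul_zero, Finset.smul_sum, and_self]
  | vec E F =>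
    refine ⟨E.card + 1, fun M hM => ⟨?_, extBraiding_setVec_eq_sum b p E F hM⟩⟩
    rw [channel_setVec, Finset.powersetCard_eq_empty.2, Finset.sum_empty]
    exact lt_of_le_of_lt (Finset.card_le_card Finset.sdiff_subset) hM

theorem beta_ne_zero_iff {p : K} (hp : p ≠ 0) (E G F H : Finset I) :
    beta p E G F H ≠ 0 ↔ alpha p G H ≠ 0 := by
  simp [beta, hp]

end Channels

end DeformedExterior

end

theorem mainTheorem6 {K V I : Type*} [Field K] [AddCommGroup V] [Module K V] [LinearOrder I]
    (b : Module.Basis I K V) (p : K) (hp : p ≠ 0) :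
    -- the braiding is the sum of its exchange channels
    (∀ x : TensorProduct K (ExteriorAlgebra K V) (ExteriorAlgebra K V),
      {k : ℕ | DeformedExterior.channel b p k x ≠ 0}.Finite ∧
      DeformedExterior.extBraiding b p x = ∑ᶠ k : ℕ, DeformedExterior.channel b p k x) ∧
    -- the matrix coefficients
    (∀ (k : ℕ) (E F G H : Finset I),
      G ∈ (E \ F).powersetCard k → H ∈ (F \ E).powersetCard k →
      DeformedExterior.exchangeCoeff b p E G F H = DeformedExterior.beta p E G F H) ∧
    -- their non-vanishing for generic `p`
    ((∀ n : ℕ, 0 < n → p ^ n ≠ 1) →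
      ∀ (k : ℕ) (E F G H : Finset I),
        G ∈ (E \ F).powersetCard k → H ∈ (F \ E).powersetCard k →
        (DeformedExterior.exchangeCoeff b p E G F H ≠ 0 ↔
          ∀ A ∈ G.powersetCard 1,
            DeformedExterior.theta A G < DeformedExterior.theta A H)) := by
  refine ⟨fun x => ?_, fun k E F G H hG hH => ?_, fun hgen k E F G H hG hH => ?_⟩
  · obtain ⟨N, hN⟩ := DeformedExterior.exists_extBraiding_eq_sum b p x
    have hs : ∀ k, DeformedExterior.channel b p k x ≠ 0 → k ∈ Finset.range N := fun k hk => by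
      rw [Finset.mem_range]
      by_contra! h
      exact hk (hN k h).1
    refine ⟨(Finset.range N).finite_toSet.subset hs, ?_⟩
    rw [(hN N le_rfl).2, finsum_eq_sum_of_support_subset _ hs]
  · rw [Finset.mem_powersetCard] at hG hH
    exact DeformedExterior.exchangeCoeff_eq_beta b p hG.1 hH.1 (hG.2.trans hH.2.symm)
  · rw [Finset.mem_powersetCard] at hG hH
    rw [DeformedExterior.exchangeCoeff_eq_beta b p hG.1 hH.1 (hG.2.trans hH.2.symm),
      DeformedExterior.beta_ne_zero_iff hp, DeformedExterior.alpha_ne_zero_iff hgen]
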